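/- Let $d\ge 1$ be an integer and let $\mu$ be the normalized Lebesgue measure $d\mu=(2\pi)^{-d}\,dx_1\cdots dx_d$ on $X=[0,2\pi]^d$. For $f\in L^1(X,\mu)$, complex valued, put $$c(n)=\int_X e^{i(n,x)}f(x)\,d\mu(x)\quad(n\in\mathbb Z^d),\qquad s_M[f](x)=\sum_{n\in\mathbb Z^d,\ \max_j|n_j|\le M}c(n)\,e^{-i(n,x)}\quad(M=1,2,\dots).$$ Let $\alpha\ge 1$ and let $\psi:[\alpha,\infty)\to(0,\infty)$ belong to the class $\Psi$, i.e. $\psi$ is continuous and strictly increasing, $p\mapsto p\log\psi(p)$ is convex, and $\psi(p)\to\infty$ as $p\to\infty$. Let $\psi_d(p)=p^d\psi(p)$. For $\theta\in\{\psi,\psi_d\}$, an Orlicz function generated by $\theta$ is an even, continuous, convex function $N:\mathbb R\to[0,\infty)$ that is strictly increasing on $[0,\infty)$, vanishes only at $0$, and satisfies $$N(u)=\exp\Big(\sup_{p\ge\alpha}\big(p\log u-p\log\theta(p)\big)\Big)\qquad\text{for all } u\ge e^2$$ (on $[-e^2,e^2]$ it is otherwise arbitrary). For such $N$ and measurable $f:X\to\mathbb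 C$ let $$\|f\|_{L(N)}=\inf_{v>0}\frac1v\Big(1+\int_X N(v|f|)\,d\mu\Big)\in[0,\infty],\qquad L(N)=\{f:\ \|f\|_{L(N)}<\infty\}.$$ Theorem. There is a constant $C=C(d,\psi)\in(0,\infty)$ such that, for every Orlicz function $N[\psi]$ generated by $\psi$, every Orlicz function $N_d[\psi]$ generated by $\psi_d$ and every $f\in L(N[\psi])$: $f$ is integrable, $s_M[f]\in L(N_d[\psi])$ for every $M\ge 1$, and $$\sup_{M\ge1}\|s_M[f]\|_{L(N_d[\psi])}\le C\,\|f\|_{L(N[\psi])}.$$ -/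

import Mathlib

open MeasureTheory Filter Set
open scoped ENNReal

namespace ExpOrlicz

/-- The class `Ψ` of generating functions with left end point `α`: continuous, positive, strictly
increasing functions on `[α, ∞)`, tending to infinity, for which `p ↦ p log ψ(p)` is convex.
Only the values on `[α, ∞)` matter. -/
structure ClassPsi (α : ℝ) (ψ : ℝ → ℝ) : Prop where
  one_le : 1 ≤ α
  continuousOn : ContinuousOn ψ (Ici α)
  pos : 0 < ψ α
  strictMonoOn : StrictMonoOn ψ (Ici α)
  convexOn : ConvexOn ℝ (Ici α) (fun p => p * Real.log (ψ p))
  tendsto : Tendsto ψ atTop atTop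

/-- The Legendre transform `[p log ψ(p)]^*(y) = sup_{p ≥ α} (p y - p log ψ(p))`. -/
noncomputable def legendre (α : ℝ) (ψ : ℝ → ℝ) (y : ℝ) : ℝ :=
  ⨆ p : Ici α, ((p : ℝ) * y - (p : ℝ) * Real.log (ψ p))

/-- For `ψ ∈ Ψ` the supremum defining `legendre` is a genuine finite supremum. -/
theorem ClassPsi.bddAbove_legendre {α : ℝ} {ψ : ℝ → ℝ} (h : ClassPsi α ψ) (y : ℝ) :
    BddAbove (range fun p : Ici α => (p : ℝ) * y - (p : ℝ) * Real.log (ψ p)) := by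
  have hpos : ∀ p ∈ Ici α, 0 < ψ p := fun p hp =>
    h.pos.trans_le (h.strictMonoOn.monotoneOn self_mem_Ici hp hp)
  obtain ⟨R, hR⟩ := eventually_atTop.1
    ((Real.tendsto_log_atTop.comp h.tendsto).eventually_ge_atTop y)
  have hc : ContinuousOn (fun p => p * y - p * Real.log (ψ p)) (Icc α R) := by
    have h1 : ContinuousOn (fun p => Real.log (ψ p)) (Icc α R) :=
      (h.continuousOn.mono Icc_subset_Ici_self).log fun p hp => (hpos p hp.1).ne'
    fun_prop
  obtain ⟨B, hB⟩ := (isCompact_Icc.image_of_continuousOn hc).bddAbove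
  refine ⟨max B 0, ?_⟩
  rintro _ ⟨⟨p, hp⟩, rfl⟩
  rcases le_total p R with hpR | hpR
  · exact le_max_of_le_left (hB ⟨p, ⟨hp, hpR⟩, rfl⟩)
  · have h2 : y ≤ Real.log (ψ p) := hR p hpR
    have h3 : 0 ≤ p := le_trans (zero_le_one.trans h.one_le) hp
    exact le_max_of_le_right (by simpa using mul_le_mul_of_nonneg_left h2 h3)

/-- `N` is an exponential Orlicz function `N([ψ], ·)` generated by `ψ`: it equals
`exp ([p log ψ(p)]^*(log u))` for `u ≥ e^2`, and on `[-e^2, e^2]` it is arbitrary subject to `N`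
being even, continuous, convex, strictly increasing on `[0, ∞)` and zero exactly at `0`. -/
structure IsOrliczFunction (α : ℝ) (ψ N : ℝ → ℝ) : Prop where
  even : ∀ u, N (-u) = N u
  continuous : Continuous N
  convexOn : ConvexOn ℝ univ N
  strictMonoOn : StrictMonoOn N (Ici 0)
  eq_zero_iff : ∀ u, N u = 0 ↔ u = 0
  eq_exp : ∀ u, Real.exp 2 ≤ u → N u = Real.exp (legendre α ψ (Real.log u))

/-- `ψ_d(p) = p^d ψ(p)`. -/
noncomputable def psiPow (d : ℕ) (ψ : ℝ → ℝ) (p : ℝ) : ℝ := p ^ d * ψ p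

/-- The Orlicz norm `inf_{v > 0} v⁻¹ (1 + ∫ N(v |f|) dμ)`, with value `∞` allowed. -/
noncomputable def orliczNorm {X : Type*} [MeasurableSpace X] (N : ℝ → ℝ) (μ : Measure X)
    (f : X → ℂ) : ℝ≥0∞ :=
  ⨅ (v : ℝ) (_ : 0 < v),
    (ENNReal.ofReal v)⁻¹ * (1 + ∫⁻ x, ENNReal.ofReal (N (v * ‖f x‖)) ∂μ)

/-- Membership in the Orlicz space `L(N) = L(N, X, μ)`. -/
def MemOrlicz {X : Type*} [MeasurableSpace X] (N : ℝ → ℝ) (μ : Measure X) (f : X → ℂ) : Prop :=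
  AEStronglyMeasurable f μ ∧ orliczNorm N μ f < ∞

/-- Normalized Lebesgue measure `(2π)^{-d} dx` on the cube `[0, 2π]^d`. -/
noncomputable def torusMeasure (d : ℕ) : Measure (Fin d → ℝ) :=
  (ENNReal.ofReal ((2 * Real.pi) ^ d))⁻¹ •
    volume.restrict (Icc (0 : Fin d → ℝ) (fun _ => 2 * Real.pi))

/-- The Fourier coefficient `c(n) = (2π)^{-d} ∫_{[0,2π]^d} exp(i(n,x)) f(x) dx`. -/
noncomputable def fourierCoef {d : ℕ} (f : (Fin d → ℝ) → ℂ) (n : Fin d → ℤ) : ℂ :=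
  ∫ x, Complex.exp (Complex.I * ∑ j, (n j : ℂ) * (x j : ℂ)) * f x ∂(torusMeasure d)

/-- The cubic partial sum `s_M[f](x) = ∑_{max_j |n_j| ≤ M} c(n) exp(-i(n,x))`. -/
noncomputable def partialSum {d : ℕ} (M : ℕ) (f : (Fin d → ℝ) → ℂ) (x : Fin d → ℝ) : ℂ :=
  ∑ n ∈ Fintype.piFinset (fun _ : Fin d => Finset.Icc (-(M : ℤ)) (M : ℤ)),
    fourierCoef f n * Complex.exp (-(Complex.I * ∑ j, (n j : ℂ) * (x j : ℂ)))

end ExpOrlicz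

namespace ExpOrlicz

/-! ### A subharmonic function and the Riesz inequality for analytic polynomials -/

/-! Extrapolation: cubic partial sums are bounded on `L^p` by `(6p)^d`, uniformly in `M`, and the
passage from `ψ` to `p^d ψ` pays exactly for the growth `p^d`.

The linear growth in `p` comes from M. Riesz's theorem on the circle. A subharmonic function
dominated by `(p|Re z|)^p - |z|^p`, up to a positive factor, bounds an analytic polynomial with real
value at `0` by `p` times its real part (`integral_norm_rpow_eval_le`). Hence projections onto
half-lines of frequencies cost `3p`, and the window `[-M, M]`, a difference of two of them, costs
`6p`. Density gives all of `L^p`. The cubic Dirichlet kernel is a tensor product, so Fubini raises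
the constant to the power `d` (`lintegral_partialSum_le`).

To pass to Orlicz norms, the supremum defining `N` is replaced by a series `Σ_j (u/ψ(p_j))^{p_j}`,
with one sequence `p_j` serving both `ψ` and `p^d ψ` (`ClassPsi.exists_discretisation`). The
sequence advances by `1`, or by less if the midpoint convexity defect of `p log ψ(p)` already
reaches `1`. Steps are then short enough that the largest term captures the supremum up to a factor,
and long enough that the series is geometric once `u` is divided by `e`. Applying the `L^p` bound to
each term and summing gives an inequality between modulars with `v` replaced by `v/(e 6^d)`
(`ClassPsi.exists_modular_le`); the infimum over `v` gives the norm inequality. -/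

theorem hasDerivAt_intervalIntegral_of_continuous {G G' : ℝ → ℝ → ℝ} (a b : ℝ)
    (hG : ∀ t θ, HasDerivAt (fun t => G t θ) (G' t θ) t)
    (hc : Continuous (Function.uncurry G)) (hc' : Continuous (Function.uncurry G')) (t : ℝ) :
    HasDerivAt (fun t => ∫ θ in a..b, G t θ) (∫ θ in a..b, G' t θ) t := by
  obtain ⟨B, hB⟩ := ((isCompact_Icc (a := t - 1) (b := t + 1)).prod
    (isCompact_uIcc (a := a) (b := b))).exists_bound_of_continuousOn hc'.continuousOn
  have h1 : ∀ t, Continuous (G t) := fun t => hc.comp (by fun_prop : Continuous fun θ => (t, θ))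
  have h2 : ∀ t, Continuous (G' t) := fun t => hc'.comp (by fun_prop : Continuous fun θ => (t, θ))
  refine (intervalIntegral.hasDerivAt_integral_of_dominated_loc_of_deriv_le
    (s := Icc (t - 1) (t + 1)) (bound := fun _ => B) (Icc_mem_nhds (by linarith) (by linarith))
    (Eventually.of_forall fun t => (h1 t).aestronglyMeasurable)
    ((h1 t).intervalIntegrable _ _) (h2 t).aestronglyMeasurable
    (Eventually.of_forall fun θ hθ x hx => hB (x, θ) ⟨hx, uIoc_subset_uIcc hθ⟩)
    intervalIntegrable_const (Eventually.of_forall fun θ _ x _ => hG x θ)).2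

/-- The function `(s + 1) x ^ 2 R ^ s - R ^ (s + 1) / (2 (s + 1))`, `R = x ^ 2 + y ^ 2`. -/
noncomputable def subharm (s x y : ℝ) : ℝ :=
  (s + 1) * (x ^ 2 * (x ^ 2 + y ^ 2) ^ s) - (x ^ 2 + y ^ 2) ^ (s + 1) / (2 * (s + 1))

noncomputable def subharmX (s x y : ℝ) : ℝ :=
  (2 * s + 1) * (x * (x ^ 2 + y ^ 2) ^ s) +
    2 * s * (s + 1) * (x ^ 3 * (x ^ 2 + y ^ 2) ^ (s - 1))

noncomputable def subharmY (s x y : ℝ) : ℝ :=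
  2 * s * (s + 1) * (x ^ 2 * y * (x ^ 2 + y ^ 2) ^ (s - 1)) - y * (x ^ 2 + y ^ 2) ^ s

noncomputable def subharmXX (s x y : ℝ) : ℝ :=
  (2 * s + 1) * (x ^ 2 + y ^ 2) ^ s +
    (2 * s * (2 * s + 1) + 6 * s * (s + 1)) * (x ^ 2 * (x ^ 2 + y ^ 2) ^ (s - 1)) +
    4 * s * (s - 1) * (s + 1) * (x ^ 4 * (x ^ 2 + y ^ 2) ^ (s - 2))

noncomputable def subharmXY (s x y : ℝ) : ℝ :=
  2 * s * (2 * s + 1) * (x * y * (x ^ 2 + y ^ 2) ^ (s - 1)) +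
    4 * s * (s - 1) * (s + 1) * (x ^ 3 * y * (x ^ 2 + y ^ 2) ^ (s - 2))

noncomputable def subharmYY (s x y : ℝ) : ℝ :=
  2 * s * (s + 1) * (x ^ 2 * (x ^ 2 + y ^ 2) ^ (s - 1)) +
    4 * s * (s - 1) * (s + 1) * (x ^ 2 * y ^ 2 * (x ^ 2 + y ^ 2) ^ (s - 2)) -
    (x ^ 2 + y ^ 2) ^ s - 2 * s * (y ^ 2 * (x ^ 2 + y ^ 2) ^ (s - 1))

theorem rpow_eq_mul_rpow_sub_one {R a : ℝ} (hR : 0 ≤ R) (ha : 1 ≤ a) :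
    R ^ a = R * R ^ (a - 1) := by
  rcases hR.eq_or_lt with rfl | hR
  · rw [Real.zero_rpow (by linarith), zero_mul]
  · rw [Real.rpow_sub_one hR.ne']; field_simp

/-- The two coefficients in `subharm` are balanced so that the pure `R ^ s` terms of the Laplacian
cancel, leaving a nonnegative multiple of `x ^ 2 * R ^ (s - 1)`. For `2 ≤ s` all powers of `R` in
the second derivatives have nonnegative exponent, so the origin causes no trouble. -/
theorem subharm_laplacian_nonneg {s : ℝ} (hs : 2 ≤ s) (x y : ℝ) :
    0 ≤ subharmXX s x y + subharmYY s x y := by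
  have hR : 0 ≤ x ^ 2 + y ^ 2 := by positivity
  have h1 := rpow_eq_mul_rpow_sub_one hR (by linarith : 1 ≤ s)
  have h2 := rpow_eq_mul_rpow_sub_one hR (by linarith : 1 ≤ s - 1)
  rw [show s - 1 - 1 = s - 2 by ring] at h2
  have : subharmXX s x y + subharmYY s x y =
      4 * s * (s + 1) * (s + 2) * (x ^ 2 * (x ^ 2 + y ^ 2) ^ (s - 1)) := by
    unfold subharmXX subharmYY
    rw [h1, h2]; ring
  rw [this]
  positivity

theorem hasDerivAt_sq_add_sq_rpow {x y : ℝ → ℝ} {x' y' t a : ℝ} (ha : 1 ≤ a)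
    (hx : HasDerivAt x x' t) (hy : HasDerivAt y y' t) :
    HasDerivAt (fun t => (x t ^ 2 + y t ^ 2) ^ a)
      (a * (x t ^ 2 + y t ^ 2) ^ (a - 1) * (2 * x t * x' + 2 * y t * y')) t := by
  have h := ((hx.fun_pow 2).add (hy.fun_pow 2)).rpow_const (p := a) (Or.inr ha)
  refine h.congr_deriv ?_
  simp only [Pi.add_apply]
  push_cast; ring

section
variable {x y : ℝ → ℝ} {x' y' t s : ℝ}

theorem hasDerivAt_subharm (hs : 2 ≤ s) (hx : HasDerivAt x x' t) (hy : HasDerivAt y y' t) :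
    HasDerivAt (fun t => subharm s (x t) (y t))
      (subharmX s (x t) (y t) * x' + subharmY s (x t) (y t) * y') t := by
  have h0 := hasDerivAt_sq_add_sq_rpow (by linarith : 1 ≤ s) hx hy
  have h1 := hasDerivAt_sq_add_sq_rpow (by linarith : 1 ≤ s + 1) hx hy
  refine ((((hx.fun_pow 2).mul h0).const_mul (s + 1)).sub
    (h1.div_const (2 * (s + 1)))).congr_deriv ?_
  have : s + 1 ≠ 0 := by linarith
  rw [show s + 1 - 1 = s by ring]
  unfold subharmX subharmY
  push_cast
  field_simp
  ring

theorem hasDerivAt_subharmX (hs : 2 ≤ s) (hx : HasDerivAt x x' t) (hy : HasDerivAt y y' t) :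
    HasDerivAt (fun t => subharmX s (x t) (y t))
      (subharmXX s (x t) (y t) * x' + subharmXY s (x t) (y t) * y') t := by
  have h0 := hasDerivAt_sq_add_sq_rpow (by linarith : 1 ≤ s) hx hy
  have h1 := hasDerivAt_sq_add_sq_rpow (by linarith : 1 ≤ s - 1) hx hy
  refine (((hx.mul h0).const_mul (2 * s + 1)).add
    (((hx.fun_pow 3).mul h1).const_mul (2 * s * (s + 1)))).congr_deriv ?_
  rw [show s - 1 - 1 = s - 2 by ring]
  unfold subharmXX subharmXY
  push_cast
  ring

theorem hasDerivAt_subharmY (hs : 2 ≤ s) (hx : HasDerivAt x x' t) (hy : HasDerivAt y y' t) :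
    HasDerivAt (fun t => subharmY s (x t) (y t))
      (subharmXY s (x t) (y t) * x' + subharmYY s (x t) (y t) * y') t := by
  have h0 := hasDerivAt_sq_add_sq_rpow (by linarith : 1 ≤ s) hx hy
  have h1 := hasDerivAt_sq_add_sq_rpow (by linarith : 1 ≤ s - 1) hx hy
  refine (((((hx.fun_pow 2).mul hy).mul h1).const_mul (2 * s * (s + 1))).sub
    (hy.mul h0)).congr_deriv ?_
  have hR := rpow_eq_mul_rpow_sub_one (by positivity : 0 ≤ x t ^ 2 + y t ^ 2)
    (by linarith : 1 ≤ s - 1)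
  rw [show s - 1 - 1 = s - 2 by ring] at hR ⊢
  unfold subharmXY subharmYY
  simp only [Pi.mul_apply]
  push_cast
  ring_nf

end

theorem continuous_sq_add_sq_rpow {a : ℝ} (ha : 0 ≤ a) {T : Type*} [TopologicalSpace T]
    {x y : T → ℝ} (hx : Continuous x) (hy : Continuous y) :
    Continuous fun t => (x t ^ 2 + y t ^ 2) ^ a :=
  ((hx.pow 2).add (hy.pow 2)).rpow_const fun _ => Or.inr ha

/-! ### Circle means of subharmonic functions of polynomials -/

/-- The operator `z d/dz` on polynomials. -/
noncomputable def eulerOp (P : Polynomial ℂ) : Polynomial ℂ := Polynomial.X * P.derivative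

theorem hasDerivAt_eval_exp (P : Polynomial ℂ) (z : ℂ) :
    HasDerivAt (fun z => P.eval (Complex.exp z)) ((eulerOp P).eval (Complex.exp z)) z := by
  refine ((P.hasDerivAt (Complex.exp z)).comp z (Complex.hasDerivAt_exp z)).congr_deriv ?_
  simp [eulerOp, mul_comm]

section
variable (P : Polynomial ℂ) (t θ : ℝ)

theorem hasDerivAt_eval_exp_left :
    HasDerivAt (fun t : ℝ => P.eval (Complex.exp (t + θ * Complex.I)))
      ((eulerOp P).eval (Complex.exp (t + θ * Complex.I))) t := by
  have h : HasDerivAt (fun t : ℝ => (t : ℂ) + θ * Complex.I) 1 t :=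
    (Complex.ofRealCLM.hasDerivAt (x := t)).add_const _
  have := HasDerivAt.comp (𝕜 := ℝ) t (hasDerivAt_eval_exp P (t + θ * Complex.I)) h
  rw [mul_one] at this
  exact this

theorem hasDerivAt_eval_exp_right :
    HasDerivAt (fun θ : ℝ => P.eval (Complex.exp (t + θ * Complex.I)))
      ((eulerOp P).eval (Complex.exp (t + θ * Complex.I)) * Complex.I) θ := by
  have h : HasDerivAt (fun θ : ℝ => (t : ℂ) + θ * Complex.I) (1 * Complex.I) θ :=
    ((Complex.ofRealCLM.hasDerivAt (x := θ)).mul_const _).const_add _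
  have := HasDerivAt.comp (𝕜 := ℝ) θ (hasDerivAt_eval_exp P (t + θ * Complex.I)) h
  rw [one_mul] at this
  exact this

theorem _root_.HasDerivAt.re_complex {f : ℝ → ℂ} {f' : ℂ} {x : ℝ} (h : HasDerivAt f f' x) :
    HasDerivAt (fun x => (f x).re) f'.re x :=
  Complex.reCLM.hasFDerivAt.comp_hasDerivAt x h

theorem _root_.HasDerivAt.im_complex {f : ℝ → ℂ} {f' : ℂ} {x : ℝ} (h : HasDerivAt f f' x) :
    HasDerivAt (fun x => (f x).im) f'.im x :=
  Complex.imCLM.hasFDerivAt.comp_hasDerivAt x h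

end

/-- The circle mean of a subharmonic function along an analytic polynomial is at least the value at
the centre. -/
theorem integral_subharm_eval_nonneg {s : ℝ} (hs : 2 ≤ s) (P : Polynomial ℂ)
    (h0 : (P.eval 0).im = 0) :
    0 ≤ ∫ θ in (0 : ℝ)..2 * Real.pi, subharm s (P.eval (Complex.exp (θ * Complex.I))).re
      (P.eval (Complex.exp (θ * Complex.I))).im := by
  have contP : ∀ Q : Polynomial ℂ, Continuous fun z : ℝ × ℝ =>
      Q.eval (Complex.exp (z.1 + z.2 * Complex.I)) := fun Q => by fun_prop
  have contR : ∀ Q : Polynomial ℂ, Continuous fun z : ℝ × ℝ =>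
      Q.eval (z.1 * Complex.exp (z.2 * Complex.I)) := fun Q => by fun_prop
  have polar : ∀ t θ : ℝ, Complex.exp (t + θ * Complex.I) =
      (Real.exp t : ℝ) * Complex.exp (θ * Complex.I) := fun t θ => by
    rw [Complex.exp_add, Complex.ofReal_exp]
  have e2 : 0 ≤ s - 2 := by linarith
  have e1 : 0 ≤ s - 1 := by linarith
  have e0 : 0 ≤ s := by linarith
  have e3 : 0 ≤ s + 1 := by linarith
  set D := eulerOp P with hD
  set D2 := eulerOp D
  have key : ∃ Φ : ℝ → ℝ, ∃ K : ℝ → ℝ, Continuous K ∧ K 0 = 0 ∧ Continuous Φ ∧ 0 ≤ Φ 0 ∧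
      Φ 1 = (∫ θ in (0 : ℝ)..2 * Real.pi, subharm s (P.eval (Complex.exp (θ * Complex.I))).re
        (P.eval (Complex.exp (θ * Complex.I))).im) ∧
      (∀ t, HasDerivAt (fun t => Φ (Real.exp t)) (K (Real.exp t)) t) ∧
      Monotone fun t => K (Real.exp t) := by
    let A : ℝ → ℝ → ℂ := fun t θ => P.eval (Complex.exp (t + θ * Complex.I))
    let B : ℝ → ℝ → ℂ := fun t θ => D.eval (Complex.exp (t + θ * Complex.I))
    let C : ℝ → ℝ → ℂ := fun t θ => D2.eval (Complex.exp (t + θ * Complex.I))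
    have cA : Continuous fun z : ℝ × ℝ => A z.1 z.2 := contP P
    have cB : Continuous fun z : ℝ × ℝ => B z.1 z.2 := contP D
    have cC : Continuous fun z : ℝ × ℝ => C z.1 z.2 := contP D2
    have At := fun t θ => hasDerivAt_eval_exp_left P t θ
    have Bt := fun t θ => hasDerivAt_eval_exp_left D t θ
    have Aθ := fun t θ => hasDerivAt_eval_exp_right P t θ
    have Bθ := fun t θ => hasDerivAt_eval_exp_right D t θ
    let G : ℝ → ℝ → ℝ := fun t θ => subharm s (A t θ).re (A t θ).im
    let Gt : ℝ → ℝ → ℝ := fun t θ => subharmX s (A t θ).re (A t θ).im * (B t θ).re +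
      subharmY s (A t θ).re (A t θ).im * (B t θ).im
    let Gtt : ℝ → ℝ → ℝ := fun t θ =>
      (subharmXX s (A t θ).re (A t θ).im * (B t θ).re +
        subharmXY s (A t θ).re (A t θ).im * (B t θ).im) * (B t θ).re +
      subharmX s (A t θ).re (A t θ).im * (C t θ).re +
      ((subharmXY s (A t θ).re (A t θ).im * (B t θ).re +
        subharmYY s (A t θ).re (A t θ).im * (B t θ).im) * (B t θ).im +
      subharmY s (A t θ).re (A t θ).im * (C t θ).im)
    -- Since `∂A/∂θ = iB`, whose real and imaginary parts are `-Im B` and `Re B`, `H` and `H'` are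
    -- the first and second `θ`-derivatives of `G`.
    let H : ℝ → ℝ → ℝ := fun t θ => subharmX s (A t θ).re (A t θ).im * (-(B t θ).im) +
      subharmY s (A t θ).re (A t θ).im * (B t θ).re
    let H' : ℝ → ℝ → ℝ := fun t θ =>
      (subharmXX s (A t θ).re (A t θ).im * (-(B t θ).im) +
        subharmXY s (A t θ).re (A t θ).im * (B t θ).re) * (-(B t θ).im) +
      subharmX s (A t θ).re (A t θ).im * (-(C t θ).re) +
      ((subharmXY s (A t θ).re (A t θ).im * (-(B t θ).im) +
        subharmYY s (A t θ).re (A t θ).im * (B t θ).re) * (B t θ).re +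
      subharmY s (A t θ).re (A t θ).im * (-(C t θ).im))
    have dG : ∀ t θ, HasDerivAt (fun t => G t θ) (Gt t θ) t := fun t θ =>
      hasDerivAt_subharm hs (At t θ).re_complex (At t θ).im_complex
    have dGt : ∀ t θ, HasDerivAt (fun t => Gt t θ) (Gtt t θ) t := fun t θ =>
      ((hasDerivAt_subharmX hs (At t θ).re_complex (At t θ).im_complex).mul
        (Bt t θ).re_complex).add
      ((hasDerivAt_subharmY hs (At t θ).re_complex (At t θ).im_complex).mul
        (Bt t θ).im_complex)
    have dH : ∀ t θ, HasDerivAt (fun θ => H t θ) (H' t θ) θ := by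
      intro t θ
      have a1 := (Aθ t θ).re_complex
      have a2 := (Aθ t θ).im_complex
      have b1 := (Bθ t θ).re_complex
      have b2 := (Bθ t θ).im_complex
      rw [Complex.mul_I_re] at a1 b1
      rw [Complex.mul_I_im] at a2 b2
      exact ((hasDerivAt_subharmX hs a1 a2).mul b2.neg).add ((hasDerivAt_subharmY hs a1 a2).mul b1)
    have cx : Continuous fun z : ℝ × ℝ => (A z.1 z.2).re := Complex.continuous_re.comp cA
    have cy : Continuous fun z : ℝ × ℝ => (A z.1 z.2).im := Complex.continuous_im.comp cA
    have cbx : Continuous fun z : ℝ × ℝ => (B z.1 z.2).re := Complex.continuous_re.comp cB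
    have cby : Continuous fun z : ℝ × ℝ => (B z.1 z.2).im := Complex.continuous_im.comp cB
    have ccx : Continuous fun z : ℝ × ℝ => (C z.1 z.2).re := Complex.continuous_re.comp cC
    have ccy : Continuous fun z : ℝ × ℝ => (C z.1 z.2).im := Complex.continuous_im.comp cC
    have r0 := continuous_sq_add_sq_rpow e0 cx cy
    have r1 := continuous_sq_add_sq_rpow e1 cx cy
    have r2 := continuous_sq_add_sq_rpow e2 cx cy
    have r3 := continuous_sq_add_sq_rpow e3 cx cy
    have cG : Continuous (Function.uncurry G) := by
      simp only [G, Function.uncurry_def, subharm]; fun_prop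
    have cGt : Continuous (Function.uncurry Gt) := by
      simp only [Gt, Function.uncurry_def, subharmX, subharmY]; fun_prop
    have cGtt : Continuous (Function.uncurry Gtt) := by
      simp only [Gtt, Function.uncurry_def, subharmX, subharmY, subharmXX, subharmXY, subharmYY]
      fun_prop
    have cH' : Continuous (Function.uncurry H') := by
      simp only [H', Function.uncurry_def, subharmX, subharmY, subharmXX, subharmXY, subharmYY]
      fun_prop
    have cont : ∀ {F : ℝ → ℝ → ℝ}, Continuous (Function.uncurry F) → ∀ t, Continuous (F t) :=
      fun h t => h.comp (by fun_prop : Continuous fun θ : ℝ => (t, θ))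
    have intH' : ∀ t, ∫ θ in (0 : ℝ)..2 * Real.pi, H' t θ = 0 := by
      intro t
      rw [intervalIntegral.integral_eq_sub_of_hasDerivAt (fun θ _ => dH t θ)
        ((cont cH' t).intervalIntegrable _ _)]
      have : ∀ Q : Polynomial ℂ, Q.eval (Complex.exp (t + (2 * Real.pi : ℝ) * Complex.I)) =
          Q.eval (Complex.exp (t + (0 : ℝ) * Complex.I)) := fun Q => by
        push_cast
        rw [Complex.exp_add, Complex.exp_two_pi_mul_I, Complex.exp_add, zero_mul, Complex.exp_zero]
      simp only [H, A, B, this, sub_self]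
    -- Adding `H'`, whose integral vanishes by periodicity, makes the mixed terms and those in `C`
    -- cancel: the integrand becomes the Laplacian of `subharm` at `A` times `|B|^2`. Thus the
    -- circle mean is convex in `t = log r`.
    have posGtt : ∀ t, 0 ≤ ∫ θ in (0 : ℝ)..2 * Real.pi, Gtt t θ := by
      intro t
      have hadd := intervalIntegral.integral_add (μ := volume) ((cont cGtt t).intervalIntegrable 0 (2 * Real.pi))
        ((cont cH' t).intervalIntegrable 0 (2 * Real.pi))
      rw [intH', add_zero] at hadd
      rw [← hadd]
      refine intervalIntegral.integral_nonneg (by positivity) fun θ _ => ?_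
      have := mul_nonneg (subharm_laplacian_nonneg hs (A t θ).re (A t θ).im)
        (add_nonneg (sq_nonneg (B t θ).re) (sq_nonneg (B t θ).im))
      calc (0 : ℝ) ≤ _ := this
        _ = _ := by simp only [Gtt, H']; ring
    have cAr : Continuous fun z : ℝ × ℝ => P.eval (z.1 * Complex.exp (z.2 * Complex.I)) := contR P
    have cBr : Continuous fun z : ℝ × ℝ => D.eval (z.1 * Complex.exp (z.2 * Complex.I)) := contR D
    have crx := Complex.continuous_re.comp cAr
    have cry := Complex.continuous_im.comp cAr
    have crbx := Complex.continuous_re.comp cBr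
    have crby := Complex.continuous_im.comp cBr
    have q0 := continuous_sq_add_sq_rpow e0 crx cry
    have q1 := continuous_sq_add_sq_rpow e1 crx cry
    have q3 := continuous_sq_add_sq_rpow e3 crx cry
    simp only [Function.comp_def] at crx cry crbx crby q0 q1 q3
    -- Written in the radius `r = e^t`, both functions are continuous up to `r = 0`, which supplies
    -- the limits as `t → -∞`.
    refine ⟨fun r => ∫ θ in (0 : ℝ)..2 * Real.pi,
        subharm s (P.eval (r * Complex.exp (θ * Complex.I))).re
          (P.eval (r * Complex.exp (θ * Complex.I))).im,
      fun r => ∫ θ in (0 : ℝ)..2 * Real.pi,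
        (subharmX s (P.eval (r * Complex.exp (θ * Complex.I))).re
          (P.eval (r * Complex.exp (θ * Complex.I))).im *
            (D.eval (r * Complex.exp (θ * Complex.I))).re +
        subharmY s (P.eval (r * Complex.exp (θ * Complex.I))).re
          (P.eval (r * Complex.exp (θ * Complex.I))).im *
            (D.eval (r * Complex.exp (θ * Complex.I))).im), ?_, ?_, ?_, ?_, ?_, ?_, ?_⟩
    · refine intervalIntegral.continuous_parametric_intervalIntegral_of_continuous' ?_ _ _
      simp only [Function.uncurry_def, subharmX, subharmY]; fun_prop
    · simp [hD, eulerOp]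
    · refine intervalIntegral.continuous_parametric_intervalIntegral_of_continuous' ?_ _ _
      simp only [Function.uncurry_def, subharm]; fun_prop
    -- At the centre `y = 0`, and the first term of `subharm` dominates the second.
    · refine intervalIntegral.integral_nonneg (by positivity) fun θ _ => ?_
      simp only [Complex.ofReal_zero, zero_mul, h0, subharm]
      set x := (P.eval 0).re
      have hx : (0 : ℝ) ≤ x ^ 2 + 0 ^ 2 := by positivity
      have := rpow_eq_mul_rpow_sub_one hx (by linarith : 1 ≤ s + 1)
      rw [this, show s + 1 - 1 = s by ring]
      have h3 : (0 : ℝ) ≤ (x ^ 2 + 0 ^ 2) ^ s := by positivity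
      generalize (x ^ 2 + 0 ^ 2) ^ s = Q at h3
      have h4 : (x ^ 2 + 0 ^ 2) * Q / (2 * (s + 1)) ≤ (x ^ 2 + 0 ^ 2) * Q :=
        div_le_self (by positivity) (by linarith)
      have h5 : 0 ≤ s * (x ^ 2 * Q) := by positivity
      linarith
    · simp
    · intro t
      have := hasDerivAt_intervalIntegral_of_continuous 0 (2 * Real.pi) dG cG cGt t
      simpa only [G, Gt, A, B, polar] using this
    · have : Monotone fun t => ∫ θ in (0 : ℝ)..2 * Real.pi, Gt t θ :=
        monotone_of_hasDerivAt_nonneg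
          (hasDerivAt_intervalIntegral_of_continuous 0 (2 * Real.pi) dGt cGt cGtt) posGtt
      simpa only [Gt, A, B, polar] using this
  obtain ⟨Φ, K, cK, K0, cΦ, Φ0, Φ1, dΦ, mK⟩ := key
  rw [← Φ1]
  have lim : ∀ F : ℝ → ℝ, Continuous F → Tendsto (fun t => F (Real.exp t)) atBot (nhds (F 0)) :=
    fun F hF => (hF.tendsto 0).comp Real.tendsto_exp_atBot
  -- The derivative is monotone in `t` and tends to `K 0 = 0` at `-∞`, so it is nonnegative.
  have posK : ∀ t, 0 ≤ K (Real.exp t) := fun t => by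
    have := mK.le_of_tendsto (lim K cK) t
    rwa [K0] at this
  have mΦ : Monotone fun t => Φ (Real.exp t) := monotone_of_hasDerivAt_nonneg dΦ posK
  have := mΦ.le_of_tendsto (lim Φ cΦ) 0
  simp only [Real.exp_zero] at this
  exact Φ0.trans this

/-! ### The Riesz inequality from subharmonicity -/

/-- The left side is `(p a)^2 R^(p-2)`; replacing the smaller of `p a` and `R` by the larger gives
one of the two terms on the right. -/
theorem young_type_bound {p a R : ℝ} (hp : 2 ≤ p) (ha : 0 ≤ a) (hR : 0 ≤ R) :
    p ^ 2 * (a ^ 2 * R ^ (p - 2)) ≤ R ^ p + (p * a) ^ p := by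
  have hsplit : ∀ b : ℝ, 0 ≤ b → b ^ p = b ^ 2 * b ^ (p - 2) := fun b hb => by
    rw [← Real.rpow_natCast b 2, ← Real.rpow_add_of_nonneg hb (by norm_num) (by linarith)]
    congr 1; push_cast; ring
  have hpa : 0 ≤ p * a := mul_nonneg (by linarith) ha
  rcases le_total (p * a) R with h | h
  · have h1 : (p * a) ^ 2 ≤ R ^ 2 := pow_le_pow_left₀ hpa h 2
    have h2 := mul_le_mul_of_nonneg_right h1 (Real.rpow_nonneg hR (p - 2))
    rw [← hsplit R hR] at h2
    have h3 := Real.rpow_nonneg hpa p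
    calc p ^ 2 * (a ^ 2 * R ^ (p - 2)) = (p * a) ^ 2 * R ^ (p - 2) := by ring
      _ ≤ _ := by linarith
  · have h1 : R ^ (p - 2) ≤ (p * a) ^ (p - 2) := Real.rpow_le_rpow hR h (by linarith)
    have h2 := mul_le_mul_of_nonneg_left h1 (sq_nonneg (p * a))
    rw [← hsplit _ hpa] at h2
    have h3 := Real.rpow_nonneg hR p
    calc p ^ 2 * (a ^ 2 * R ^ (p - 2)) = (p * a) ^ 2 * R ^ (p - 2) := by ring
      _ ≤ _ := by linarith

/-- With `s = (p - 2) / 2` the left side is `p^2 x^2 |z|^(p-2) - 2 |z|^p`. The bound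
`young_type_bound` uses up one of the two copies of `|z|^p`, and the other survives. -/
theorem subharm_le {p : ℝ} (hp : 6 ≤ p) (z : ℂ) :
    2 * p * subharm ((p - 2) / 2) z.re z.im ≤ (p * |z.re|) ^ p - ‖z‖ ^ p := by
  have hR : z.re ^ 2 + z.im ^ 2 = ‖z‖ ^ (2 : ℝ) := by
    rw [Real.rpow_two, Complex.sq_norm, Complex.normSq_apply]; ring
  have h := young_type_bound (by linarith : 2 ≤ p) (abs_nonneg z.re) (norm_nonneg z)
  unfold subharm
  rw [hR, ← Real.rpow_mul (norm_nonneg _), ← Real.rpow_mul (norm_nonneg _),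
    show 2 * ((p - 2) / 2) = p - 2 by ring, show 2 * ((p - 2) / 2 + 1) = p by ring]
  rw [sq_abs] at h
  have hp0 : p ≠ 0 := by linarith
  have : 2 * p * (((p - 2) / 2 + 1) * (z.re ^ 2 * ‖z‖ ^ (p - 2)) - ‖z‖ ^ p / p) =
      p ^ 2 * (z.re ^ 2 * ‖z‖ ^ (p - 2)) - 2 * ‖z‖ ^ p := by field_simp; ring
  rw [this]; linarith

/-- M. Riesz's inequality for analytic polynomials, with a constant of order `p`. -/
theorem integral_norm_rpow_eval_le {p : ℝ} (hp : 6 ≤ p) (P : Polynomial ℂ)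
    (h0 : (P.eval 0).im = 0) :
    (∫ θ in (0 : ℝ)..2 * Real.pi, ‖P.eval (Complex.exp (θ * Complex.I))‖ ^ p) ≤
      ∫ θ in (0 : ℝ)..2 * Real.pi, (p * |(P.eval (Complex.exp (θ * Complex.I))).re|) ^ p := by
  have hp0 : 0 ≤ p := by linarith
  -- This is where the threshold `6` for the exponent originates.
  have hs : (2 : ℝ) ≤ (p - 2) / 2 := by linarith
  have cP : Continuous fun θ : ℝ => P.eval (Complex.exp (θ * Complex.I)) := by fun_prop
  have c1 : Continuous fun θ : ℝ => ‖P.eval (Complex.exp (θ * Complex.I))‖ ^ p :=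
    cP.norm.rpow_const fun _ => Or.inr hp0
  have c2 : Continuous fun θ : ℝ => (p * |(P.eval (Complex.exp (θ * Complex.I))).re|) ^ p :=
    ((Complex.continuous_re.comp cP).abs.const_mul p).rpow_const fun _ => Or.inr hp0
  have cx : Continuous fun θ : ℝ => (P.eval (Complex.exp (θ * Complex.I))).re :=
    Complex.continuous_re.comp cP
  have cy : Continuous fun θ : ℝ => (P.eval (Complex.exp (θ * Complex.I))).im :=
    Complex.continuous_im.comp cP
  have c3 : Continuous fun θ : ℝ => subharm ((p - 2) / 2)
      (P.eval (Complex.exp (θ * Complex.I))).re (P.eval (Complex.exp (θ * Complex.I))).im := by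
    have r0 := continuous_sq_add_sq_rpow (by linarith : 0 ≤ (p - 2) / 2) cx cy
    have r1 := continuous_sq_add_sq_rpow (by linarith : 0 ≤ (p - 2) / 2 + 1) cx cy
    simp only [subharm]; fun_prop
  have h1 := integral_subharm_eval_nonneg hs P h0
  have h2 : (∫ θ in (0 : ℝ)..2 * Real.pi, 2 * p * subharm ((p - 2) / 2)
      (P.eval (Complex.exp (θ * Complex.I))).re (P.eval (Complex.exp (θ * Complex.I))).im) ≤
      ∫ θ in (0 : ℝ)..2 * Real.pi, ((p * |(P.eval (Complex.exp (θ * Complex.I))).re|) ^ p -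
        ‖P.eval (Complex.exp (θ * Complex.I))‖ ^ p) :=
    intervalIntegral.integral_mono_on (by positivity) ((c3.const_mul _).intervalIntegrable _ _)
      ((c2.sub c1).intervalIntegrable _ _) fun θ _ => subharm_le hp _
  rw [intervalIntegral.integral_const_mul, intervalIntegral.integral_sub
    (c2.intervalIntegrable _ _) (c1.intervalIntegrable _ _)] at h2
  have h3 := mul_nonneg (by linarith : 0 ≤ 2 * p) h1
  linarith

/-! ### Trigonometric polynomials on the circle -/

instance factTwoPi : Fact (0 < 2 * Real.pi) := ⟨by positivity⟩

/-- The circle `ℝ / 2πℤ`. -/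
abbrev Circ : Type := AddCircle (2 * Real.pi)

theorem fourier_coe_two_pi (n : ℤ) (θ : ℝ) :
    fourier n (θ : Circ) = Complex.exp (Complex.I * (n * θ)) := by
  rw [fourier_coe_apply]
  congr 1
  have : (Real.pi : ℂ) ≠ 0 := by exact_mod_cast Real.pi_ne_zero
  push_cast; field_simp

theorem lintegral_haarAddCircle (F : Circ → ℝ≥0∞) :
    ∫⁻ t, F t ∂(AddCircle.haarAddCircle : Measure Circ) =
      (ENNReal.ofReal (2 * Real.pi))⁻¹ * ∫⁻ θ in Ioc 0 (2 * Real.pi), F (θ : Circ) := by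
  have h := AddCircle.lintegral_preimage (2 * Real.pi) 0 F
  rw [zero_add] at h
  rw [h, AddCircle.volume_eq_smul_haarAddCircle, lintegral_smul_measure, smul_eq_mul, ← mul_assoc,
    ENNReal.inv_mul_cancel (by simp [Real.pi_pos]) ENNReal.ofReal_ne_top, one_mul]

theorem lintegral_eval_fourier_le {p : ℝ} (hp : 6 ≤ p) (P : Polynomial ℂ)
    (h0 : (P.eval 0).im = 0) :
    ∫⁻ t, ‖P.eval (fourier 1 t)‖ₑ ^ p ∂(AddCircle.haarAddCircle : Measure Circ) ≤
      ∫⁻ t, (ENNReal.ofReal p * ‖(P.eval (fourier 1 t)).re‖ₑ) ^ p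
        ∂(AddCircle.haarAddCircle : Measure Circ) := by
  have hp0 : 0 ≤ p := by linarith
  rw [lintegral_haarAddCircle, lintegral_haarAddCircle]
  gcongr 1
  have cP : Continuous fun θ : ℝ => P.eval (Complex.exp (θ * Complex.I)) := by fun_prop
  have c1 : Continuous fun θ : ℝ => ‖P.eval (Complex.exp (θ * Complex.I))‖ ^ p :=
    cP.norm.rpow_const fun _ => Or.inr hp0
  have c2 : Continuous fun θ : ℝ => (p * |(P.eval (Complex.exp (θ * Complex.I))).re|) ^ p :=
    ((Complex.continuous_re.comp cP).abs.const_mul p).rpow_const fun _ => Or.inr hp0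
  have conv : ∀ g : ℝ → ℝ, Continuous g → (∀ x, 0 ≤ g x) →
      ∫⁻ θ in Ioc 0 (2 * Real.pi), ENNReal.ofReal (g θ) =
        ENNReal.ofReal (∫ θ in (0 : ℝ)..2 * Real.pi, g θ) := fun g hg h => by
    rw [intervalIntegral.integral_of_le (by positivity),
      ofReal_integral_eq_lintegral_ofReal (hg.integrableOn_Ioc) (Eventually.of_forall h)]
  have e : ∀ θ : ℝ, fourier 1 (θ : Circ) = Complex.exp (θ * Complex.I) := fun θ => by
    rw [fourier_coe_two_pi]; congr 1; push_cast; ring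
  calc _ = ∫⁻ θ in Ioc 0 (2 * Real.pi),
        ENNReal.ofReal (‖P.eval (Complex.exp (θ * Complex.I))‖ ^ p) := by
        refine lintegral_congr fun θ => ?_
        rw [e, ← ofReal_norm, ENNReal.ofReal_rpow_of_nonneg (norm_nonneg _) hp0]
    _ ≤ ∫⁻ θ in Ioc 0 (2 * Real.pi),
        ENNReal.ofReal ((p * |(P.eval (Complex.exp (θ * Complex.I))).re|) ^ p) := by
        rw [conv _ c1 fun _ => by positivity, conv _ c2 fun _ => by positivity]
        exact ENNReal.ofReal_le_ofReal (integral_norm_rpow_eval_le hp P h0)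
    _ = _ := by
        refine lintegral_congr fun θ => ?_
        rw [e, ← ofReal_norm, ← ENNReal.ofReal_mul hp0, Real.norm_eq_abs,
          ENNReal.ofReal_rpow_of_nonneg (by positivity) hp0]

theorem eLpNorm_eval_fourier_le {p : ℝ} (hp : 6 ≤ p) (P : Polynomial ℂ)
    (h0 : (P.eval 0).im = 0) :
    eLpNorm (fun t => P.eval (fourier 1 t)) (ENNReal.ofReal p)
        (AddCircle.haarAddCircle : Measure Circ) ≤
      ENNReal.ofReal p * eLpNorm (fun t => (P.eval (fourier 1 t)).re) (ENNReal.ofReal p)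
        (AddCircle.haarAddCircle : Measure Circ) := by
  have hp0 : 0 < p := by linarith
  have h1 : ENNReal.ofReal p ≠ 0 := by simpa using hp0
  rw [eLpNorm_eq_lintegral_rpow_enorm_toReal h1 ENNReal.ofReal_ne_top,
    eLpNorm_eq_lintegral_rpow_enorm_toReal h1 ENNReal.ofReal_ne_top,
    ENNReal.toReal_ofReal hp0.le]
  have h := lintegral_eval_fourier_le hp P h0
  simp only [ENNReal.mul_rpow_of_nonneg _ _ hp0.le] at h
  rw [lintegral_const_mul' _ _ (by simp [hp0.le])] at h
  calc _ ≤ (ENNReal.ofReal p ^ p * ∫⁻ t, ‖(P.eval (fourier 1 t)).re‖ₑ ^ p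
        ∂(AddCircle.haarAddCircle : Measure Circ)) ^ (1 / p) := by gcongr
    _ = _ := by
        rw [ENNReal.mul_rpow_of_nonneg _ _ (by positivity), ← ENNReal.rpow_mul,
          mul_one_div_cancel hp0.ne', ENNReal.rpow_one]

/-- The analytic polynomial whose real part on the unit circle is that of `c z ^ n`. -/
noncomputable def analyticPart (n : ℤ) (c : ℂ) : Polynomial ℂ :=
  if n = 0 then Polynomial.C (c.re : ℂ) else
    if 0 < n then Polynomial.C c * Polynomial.X ^ n.toNat
    else Polynomial.C (starRingEnd ℂ c) * Polynomial.X ^ (-n).toNat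

theorem eval_zero_analyticPart_im (n : ℤ) (c : ℂ) : ((analyticPart n c).eval 0).im = 0 := by
  unfold analyticPart
  split_ifs with h h'
  · simp
  · have : n.toNat ≠ 0 := by omega
    simp [this]
  · have : (-n).toNat ≠ 0 := by omega
    simp [this]

theorem fourier_one_pow (k : ℕ) (t : Circ) : (fourier 1 t : ℂ) ^ k = fourier (k : ℤ) t := by
  induction k with
  | zero => simp
  | succ k ih => rw [pow_succ, ih, ← fourier_add]; push_cast; rfl

theorem eval_analyticPart_re (n : ℤ) (c : ℂ) (t : Circ) :
    ((analyticPart n c).eval (fourier 1 t)).re = (c * fourier n t).re := by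
  unfold analyticPart
  split_ifs with h h'
  · subst h; simp
  · simp only [Polynomial.eval_mul, Polynomial.eval_C, Polynomial.eval_pow, Polynomial.eval_X,
      fourier_one_pow, Int.toNat_of_nonneg h'.le]
  · have h2 : (0 : ℤ) ≤ -n := by omega
    simp only [Polynomial.eval_mul, Polynomial.eval_C, Polynomial.eval_pow, Polynomial.eval_X,
      fourier_one_pow, Int.toNat_of_nonneg h2, fourier_neg]
    simp

/-- The coefficients `c` and `-ic` produce analytic polynomials with boundary real parts `Re f` and
`Im f`. In this combination positive frequencies double, while negative ones cancel because
conjugation turns `-i` into `i`. -/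
theorem eval_analyticPart_add (n : ℤ) (c : ℂ) (t : Circ) :
    (analyticPart n c).eval (fourier 1 t) +
        Complex.I * (analyticPart n (-Complex.I * c)).eval (fourier 1 t) =
      (if n = 0 then c else 0) + 2 * (if 1 ≤ n then c * fourier n t else 0) := by
  unfold analyticPart
  split_ifs with h h' h'
  · omega
  · simp only [Polynomial.eval_C]
    apply Complex.ext <;> simp
  · simp only [Polynomial.eval_mul, Polynomial.eval_C, Polynomial.eval_pow, Polynomial.eval_X,
      fourier_one_pow, Int.toNat_of_nonneg (by omega : 0 ≤ n)]
    linear_combination -(c * fourier n t) * Complex.I_sq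
  · omega
  · omega
  · simp only [Polynomial.eval_mul, Polynomial.eval_C, Polynomial.eval_pow, Polynomial.eval_X,
      map_mul, map_neg, Complex.conj_I, neg_neg]
    linear_combination (starRingEnd ℂ c * fourier 1 t ^ (-n).toNat) * Complex.I_sq

section
variable {ι : Type*} (s : Finset ι) (n : ι → ℤ) (c : ι → ℂ)

/-- A trigonometric polynomial on the circle. -/
noncomputable def trigPoly (t : Circ) : ℂ := ∑ i ∈ s, c i * fourier (n i) t

theorem continuous_trigPoly : Continuous (trigPoly s n c) := by
  unfold trigPoly; fun_prop

theorem integral_trigPoly :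
    ∫ t, trigPoly s n c t ∂(AddCircle.haarAddCircle : Measure Circ) =
      ∑ i ∈ s, if n i = 0 then c i else 0 := by
  unfold trigPoly
  rw [integral_finsetSum _ fun i _ => (Continuous.integrable_of_hasCompactSupport (by fun_prop)
    (HasCompactSupport.of_compactSpace _))]
  refine Finset.sum_congr rfl fun i _ => ?_
  rw [integral_const_mul]
  have := fourierCoeff_fourier (T := 2 * Real.pi) (n i)
  have h0 := congrFun this 0
  simp only [fourierCoeff, neg_zero, fourier_zero, one_smul] at h0
  rw [h0, Pi.single_apply]
  by_cases h : n i = 0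
  · simp [h]
  · simp [h, Ne.symm h]

theorem eLpNorm_trigPoly_positive_le {p : ℝ} (hp : 6 ≤ p) :
    eLpNorm (trigPoly (s.filter fun i => 1 ≤ n i) n c) (ENNReal.ofReal p)
        (AddCircle.haarAddCircle : Measure Circ) ≤
      ENNReal.ofReal (3 * p) * eLpNorm (trigPoly s n c) (ENNReal.ofReal p)
        (AddCircle.haarAddCircle : Measure Circ) := by
  set μ := (AddCircle.haarAddCircle : Measure Circ)
  set q := ENNReal.ofReal p
  have hq : 1 ≤ q := by
    rw [← ENNReal.ofReal_one]; exact ENNReal.ofReal_le_ofReal (by linarith)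
  set f := trigPoly s n c with hf
  have cf : Continuous f := continuous_trigPoly s n c
  let F : (ι → ℂ) → Polynomial ℂ := fun b => ∑ i ∈ s, analyticPart (n i) (b i)
  have hF : ∀ b, eLpNorm (fun t => (F b).eval (fourier 1 t)) q μ ≤
      q * eLpNorm (trigPoly s n b) q μ := fun b => by
    have h0 : ((F b).eval 0).im = 0 := by
      simp [F, Polynomial.eval_finsetSum, eval_zero_analyticPart_im]
    refine (eLpNorm_eval_fourier_le hp (F b) h0).trans ?_
    gcongr
    refine eLpNorm_mono fun t => ?_
    have : ((F b).eval (fourier 1 t)).re = (trigPoly s n b t).re := by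
      simp only [F, Polynomial.eval_finsetSum, Complex.re_sum, eval_analyticPart_re, trigPoly]
    rw [this]
    exact Complex.abs_re_le_norm _
  let c' : ι → ℂ := fun i => -Complex.I * c i
  have hc' : eLpNorm (trigPoly s n c') q μ = eLpNorm f q μ := by
    refine eLpNorm_congr_norm_ae (Eventually.of_forall fun t => ?_)
    have : trigPoly s n c' t = -Complex.I * f t := by
      simp only [hf, trigPoly, Finset.mul_sum, c', mul_assoc]
    rw [this]; simp
  -- The mean is the zero-frequency term left over by `eval_analyticPart_add`; on a probability
  -- space it costs at most one further copy of the norm of `f`.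
  set A := ∫ t, f t ∂μ with hA
  have hAn : eLpNorm (fun _ : Circ => A) q μ ≤ eLpNorm f q μ := by
    rw [eLpNorm_const A (by positivity) (NeZero.ne μ)]
    simp only [measure_univ, ENNReal.one_rpow, mul_one]
    calc ‖A‖ₑ ≤ ∫⁻ t, ‖f t‖ₑ ∂μ := enorm_integral_le_lintegral_enorm _
      _ = eLpNorm f 1 μ := eLpNorm_one_eq_lintegral_enorm.symm
      _ ≤ _ := eLpNorm_le_eLpNorm_of_exponent_le hq cf.aestronglyMeasurable
  set g := trigPoly (s.filter fun i => 1 ≤ n i) n c with hg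
  have key : ∀ t, (F c).eval (fourier 1 t) + Complex.I * (F c').eval (fourier 1 t) - A =
      2 * g t := by
    intro t
    rw [hA, hf, integral_trigPoly]
    simp only [F, Polynomial.eval_finsetSum, Finset.mul_sum, ← Finset.sum_add_distrib,
      ← Finset.sum_sub_distrib, hg, trigPoly, Finset.sum_filter]
    refine Finset.sum_congr rfl fun i _ => ?_
    rw [eval_analyticPart_add, add_sub_cancel_left]
  have m1 : ∀ b, AEStronglyMeasurable (fun t => (F b).eval (fourier 1 t)) μ := fun b =>
    (Continuous.aestronglyMeasurable (by fun_prop))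
  have m2 : AEStronglyMeasurable (fun t => Complex.I * (F c').eval (fourier 1 t)) μ :=
    (Continuous.aestronglyMeasurable (by fun_prop))
  calc eLpNorm g q μ
      ≤ eLpNorm ((fun t => (F c).eval (fourier 1 t)) +
          (fun t => Complex.I * (F c').eval (fourier 1 t)) - fun _ => A) q μ := by
        refine eLpNorm_mono fun t => ?_
        have := key t
        simp only [Pi.sub_apply, Pi.add_apply]
        rw [this, norm_mul]
        have := norm_nonneg (g t)
        norm_num
        linarith
    _ ≤ q * eLpNorm f q μ + q * eLpNorm f q μ + eLpNorm f q μ := by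
        refine (eLpNorm_sub_le ((m1 c).add m2) aestronglyMeasurable_const hq).trans ?_
        gcongr
        refine (eLpNorm_add_le (m1 c) m2 hq).trans ?_
        gcongr
        · exact hF c
        · rw [← hc']
          refine le_trans (eLpNorm_mono fun t => ?_) (hF c')
          simp
    _ ≤ q * eLpNorm f q μ + q * eLpNorm f q μ + q * eLpNorm f q μ := by
        gcongr
        exact le_mul_of_one_le_left (by positivity) hq
    _ = _ := by
        rw [ENNReal.ofReal_mul (by norm_num)]
        have : ENNReal.ofReal 3 = 3 := by norm_num
        rw [this]; ring

/-- Multiplication by the unimodular character `fourier (-k)` moves the cut from `k` to `0` and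
preserves all norms. -/
theorem eLpNorm_trigPoly_gt_le {p : ℝ} (hp : 6 ≤ p) (k : ℤ) :
    eLpNorm (trigPoly (s.filter fun i => k < n i) n c) (ENNReal.ofReal p)
        (AddCircle.haarAddCircle : Measure Circ) ≤
      ENNReal.ofReal (3 * p) * eLpNorm (trigPoly s n c) (ENNReal.ofReal p)
        (AddCircle.haarAddCircle : Measure Circ) := by
  have h := eLpNorm_trigPoly_positive_le s (fun i => n i - k) c hp
  have hshift : ∀ (u : Finset ι) (t : Circ),
      ‖trigPoly u (fun i => n i - k) c t‖ = ‖trigPoly u n c t‖ := fun u t => by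
    have : trigPoly u (fun i => n i - k) c t = fourier (-k) t * trigPoly u n c t := by
      simp only [trigPoly, Finset.mul_sum]
      refine Finset.sum_congr rfl fun i _ => ?_
      rw [sub_eq_add_neg, fourier_add]; ring
    rw [this, norm_mul, fourier_apply, Circle.norm_coe, one_mul]
  rw [eLpNorm_congr_norm_ae (Eventually.of_forall (hshift s)),
    eLpNorm_congr_norm_ae (Eventually.of_forall (hshift _))] at h
  convert h using 5
  omega

/-- The window is the difference of the half-lines `n > -M - 1` and `n > M`, so the constant is `3p
+ 3p`, independent of `M`. -/
theorem eLpNorm_trigPoly_abs_le {p : ℝ} (hp : 6 ≤ p) (M : ℕ) :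
    eLpNorm (trigPoly (s.filter fun i => n i ∈ Finset.Icc (-(M : ℤ)) M) n c) (ENNReal.ofReal p)
        (AddCircle.haarAddCircle : Measure Circ) ≤
      ENNReal.ofReal (6 * p) * eLpNorm (trigPoly s n c) (ENNReal.ofReal p)
        (AddCircle.haarAddCircle : Measure Circ) := by
  have hq : 1 ≤ ENNReal.ofReal p := by
    rw [← ENNReal.ofReal_one]; exact ENNReal.ofReal_le_ofReal (by linarith)
  have : trigPoly (s.filter fun i => n i ∈ Finset.Icc (-(M : ℤ)) M) n c =
      trigPoly (s.filter fun i => -(M : ℤ) - 1 < n i) n c -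
        trigPoly (s.filter fun i => (M : ℤ) < n i) n c := by
    ext t
    simp only [Pi.sub_apply, trigPoly, Finset.sum_filter, ← Finset.sum_sub_distrib]
    refine Finset.sum_congr rfl fun i _ => ?_
    simp only [Finset.mem_Icc]
    split_ifs <;> first | omega | simp
  rw [this]
  refine (eLpNorm_sub_le (continuous_trigPoly _ _ _).aestronglyMeasurable
    (continuous_trigPoly _ _ _).aestronglyMeasurable hq).trans ?_
  refine (add_le_add (eLpNorm_trigPoly_gt_le s n c hp _)
    (eLpNorm_trigPoly_gt_le s n c hp _)).trans_eq ?_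
  rw [← add_mul, ← ENNReal.ofReal_add (by linarith) (by linarith)]
  congr 2; ring

end

/-! ### Fourier partial sums on the circle and on the interval -/

/-- The partial Fourier sum on the circle. -/
noncomputable def circleSum (M : ℕ) (g : Circ → ℂ) (t : Circ) : ℂ :=
  ∑ n ∈ Finset.Icc (-(M : ℤ)) M, fourierCoeff g n * fourier n t

section
variable (M : ℕ)

theorem circleSum_trigPoly (c : ℤ → ℂ) (s : Finset ℤ) :
    circleSum M (trigPoly s id c) =
      trigPoly (s.filter fun i => id i ∈ Finset.Icc (-(M : ℤ)) M) id c := by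
  have hc : ∀ m, fourierCoeff (trigPoly s id c) m = ∑ i ∈ s, if i = m then c i else 0 := by
    intro m
    have h : trigPoly s id c = ∑ i ∈ s, fun t => c i * (fourier i t : ℂ) := by
      ext t; simp [trigPoly, Finset.sum_apply]
    rw [h, fourierCoeff.sum _ _ fun i _ => (Continuous.integrable_of_hasCompactSupport
      (by fun_prop) (HasCompactSupport.of_compactSpace _)), Finset.sum_apply]
    refine Finset.sum_congr rfl fun i _ => ?_
    rw [fourierCoeff.const_mul, fourierCoeff_fourier, Pi.single_apply]
    by_cases h : i = m
    · simp [h]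
    · simp [h, Ne.symm h]
  ext t
  simp only [circleSum, hc, Finset.sum_mul, trigPoly, id, Finset.sum_filter]
  rw [Finset.sum_comm]
  refine Finset.sum_congr rfl fun i _ => ?_
  simp only [ite_mul, zero_mul]
  rw [Finset.sum_ite_eq]

theorem continuous_circleSum (g : Circ → ℂ) : Continuous (circleSum M g) := by
  unfold circleSum; fun_prop

theorem circleSum_add {g h : Circ → ℂ} (hg : Integrable g AddCircle.haarAddCircle)
    (hh : Integrable h AddCircle.haarAddCircle) :
    circleSum M (g + h) = circleSum M g + circleSum M h := by
  ext t
  simp only [circleSum, fourierCoeff.add hg hh, Pi.add_apply, add_mul, Finset.sum_add_distrib]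

/-- A crude bound depending on `M`, sufficient for the approximation error in the density argument.
-/
theorem eLpNorm_circleSum_le_card {q : ℝ≥0∞} (hq : 1 ≤ q) {g : Circ → ℂ}
    (hg : AEStronglyMeasurable g AddCircle.haarAddCircle) :
    eLpNorm (circleSum M g) q AddCircle.haarAddCircle ≤
      (Finset.Icc (-(M : ℤ)) M).card * eLpNorm g q AddCircle.haarAddCircle := by
  have hc : ∀ n, ‖fourierCoeff g n‖ₑ ≤ eLpNorm g q AddCircle.haarAddCircle := fun n => by
    refine (enorm_integral_le_lintegral_enorm _).trans ?_
    refine le_trans (le_of_eq ?_) (eLpNorm_le_eLpNorm_of_exponent_le hq hg)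
    rw [eLpNorm_one_eq_lintegral_enorm]
    refine lintegral_congr fun t => ?_
    rw [← ofReal_norm, ← ofReal_norm, norm_smul, fourier_apply, Circle.norm_coe, one_mul]
  have h : circleSum M g = ∑ n ∈ Finset.Icc (-(M : ℤ)) M,
      fun t => fourierCoeff g n * (fourier n t : ℂ) := by
    ext t; simp [circleSum, Finset.sum_apply]
  rw [h]
  refine (eLpNorm_sum_le (fun n _ => Continuous.aestronglyMeasurable (by fun_prop)) hq).trans ?_
  rw [← nsmul_eq_mul]
  refine Finset.sum_le_card_nsmul _ _ _ fun n _ => ?_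
  have : eLpNorm (fun t : Circ => fourierCoeff g n * (fourier n t : ℂ)) q
      AddCircle.haarAddCircle =
      eLpNorm (fun _ : Circ => fourierCoeff g n) q AddCircle.haarAddCircle :=
    eLpNorm_congr_norm_ae (Eventually.of_forall fun t => by
      rw [norm_mul, fourier_apply, Circle.norm_coe, mul_one])
  rw [this, eLpNorm_const _ (by positivity) (NeZero.ne _)]
  simpa using hc n

theorem exists_trigPoly_eLpNorm_sub_lt {q : ℝ≥0∞} (hq : 1 ≤ q) (hq' : q ≠ ∞) {g : Circ → ℂ}
    (hg : MemLp g q AddCircle.haarAddCircle) {ε : ℝ≥0∞} (hε : 0 < ε) :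
    ∃ (s : Finset ℤ) (c : ℤ → ℂ),
      eLpNorm (g - trigPoly s id c) q AddCircle.haarAddCircle < ε := by
  have : Fact (1 ≤ q) := ⟨hq⟩
  have hmem : hg.toLp g ∈ (Submodule.span ℂ
      (range (fourierLp (T := 2 * Real.pi) q))).topologicalClosure := by
    rw [span_fourierLp_closure_eq_top hq']; trivial
  rw [← SetLike.mem_coe, Submodule.topologicalClosure_coe, EMetric.mem_closure_iff] at hmem
  obtain ⟨y, hy, hd⟩ := hmem ε hε
  obtain ⟨c, rfl⟩ := Finsupp.mem_span_range_iff_exists_finsupp.1 hy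
  refine ⟨c.support, c, ?_⟩
  have hsum : (c.sum fun i a => a • fourierLp (T := 2 * Real.pi) q i) =
      ContinuousMap.toLp q AddCircle.haarAddCircle ℂ (∑ i ∈ c.support, c i • fourier i) := by
    rw [map_sum]; simp only [map_smul]; rfl
  rw [hsum, Lp.edist_def] at hd
  refine lt_of_le_of_lt (le_of_eq (eLpNorm_congr_ae ?_)) hd
  filter_upwards [hg.coeFn_toLp, ContinuousMap.coeFn_toLp (p := q) (𝕜 := ℂ)
    AddCircle.haarAddCircle (∑ i ∈ c.support, c i • fourier (T := 2 * Real.pi) i)] with t h1 h2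
  simp only [Pi.sub_apply, h1, h2, trigPoly]
  simp [ContinuousMap.sum_apply]

/-- Trigonometric polynomials are dense in `L^p`. The sharp bound handles the approximant and the
crude one the remainder; with `M` fixed, the error disappears as `ε → 0`. -/
theorem eLpNorm_circleSum_le {p : ℝ} (hp : 6 ≤ p) {g : Circ → ℂ}
    (hg : MemLp g (ENNReal.ofReal p) AddCircle.haarAddCircle) :
    eLpNorm (circleSum M g) (ENNReal.ofReal p) AddCircle.haarAddCircle ≤
      ENNReal.ofReal (6 * p) * eLpNorm g (ENNReal.ofReal p) AddCircle.haarAddCircle := by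
  set q := ENNReal.ofReal p with hqdef
  have hq : 1 ≤ q := by
    rw [← ENNReal.ofReal_one]; exact ENNReal.ofReal_le_ofReal (by linarith)
  set K : ℝ≥0∞ := ((Finset.Icc (-(M : ℤ)) (M : ℤ)).card : ℝ≥0∞)
  set C := ENNReal.ofReal (6 * p)
  have main : ∀ ε : ℝ≥0∞, 0 < ε → eLpNorm (circleSum M g) q AddCircle.haarAddCircle ≤
      C * (eLpNorm g q AddCircle.haarAddCircle + ε) + K * ε := by
    intro ε hε
    obtain ⟨s, c, hs⟩ := exists_trigPoly_eLpNorm_sub_lt hq ENNReal.ofReal_ne_top hg hε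
    have ch := continuous_trigPoly s id c
    have hm : MemLp (trigPoly s id c) q AddCircle.haarAddCircle :=
      ch.memLp_of_hasCompactSupport (HasCompactSupport.of_compactSpace _)
    have hr := hg.sub hm
    have hsplit : circleSum M g =
        circleSum M (trigPoly s id c) + circleSum M (g - trigPoly s id c) := by
      rw [← circleSum_add M (hm.integrable hq) (hr.integrable hq), add_sub_cancel]
    have hnorm : eLpNorm (trigPoly s id c) q AddCircle.haarAddCircle ≤
        eLpNorm g q AddCircle.haarAddCircle + ε := by
      have := eLpNorm_sub_le hg.1 hr.1 hq
      rw [sub_sub_cancel] at this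
      exact this.trans (by gcongr)
    rw [hsplit]
    refine (eLpNorm_add_le (continuous_circleSum _ _).aestronglyMeasurable
      (continuous_circleSum _ _).aestronglyMeasurable hq).trans (add_le_add ?_ ?_)
    · rw [circleSum_trigPoly]
      exact (eLpNorm_trigPoly_abs_le s id c hp M).trans (by gcongr)
    · exact (eLpNorm_circleSum_le_card M hq hr.1).trans (by gcongr)
  have lim : Tendsto (fun ε : ℝ≥0∞ =>
      C * (eLpNorm g q AddCircle.haarAddCircle + ε) + K * ε) (nhdsWithin 0 (Ioi 0))
      (nhds (C * (eLpNorm g q AddCircle.haarAddCircle + 0) + K * 0)) := by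
    refine Tendsto.mono_left ?_ nhdsWithin_le_nhds
    refine Tendsto.add (ENNReal.Tendsto.const_mul (tendsto_const_nhds.add tendsto_id)
      (Or.inr ENNReal.ofReal_ne_top)) (ENNReal.Tendsto.const_mul tendsto_id
      (Or.inr (ENNReal.natCast_ne_top _)))
  rw [add_zero, mul_zero, add_zero] at lim
  exact ge_of_tendsto lim (eventually_mem_nhdsWithin.mono fun ε hε => main ε hε)

end

/-! ### Transfer from the circle to the interval -/

/-- Normalized Lebesgue measure on `[0, 2π]`. -/
noncomputable def intervalMeasure : Measure ℝ :=
  (ENNReal.ofReal (2 * Real.pi))⁻¹ • volume.restrict (Icc 0 (2 * Real.pi))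

instance : IsProbabilityMeasure intervalMeasure := ⟨by
  simp only [intervalMeasure, Measure.smul_apply, Measure.restrict_apply_univ, Real.volume_Icc,
    sub_zero, smul_eq_mul]
  exact ENNReal.inv_mul_cancel (by simp [Real.pi_pos]) ENNReal.ofReal_ne_top⟩

theorem measurePreserving_coe_circ :
    MeasurePreserving (fun x : ℝ => (x : Circ)) intervalMeasure AddCircle.haarAddCircle := by
  have h := AddCircle.measurePreserving_mk (2 * Real.pi) 0
  rw [zero_add, Measure.restrict_congr_set Ioc_ae_eq_Icc] at h
  refine ⟨h.measurable, ?_⟩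
  rw [intervalMeasure, Measure.map_smul]
  erw [h.map_eq]
  rw [AddCircle.volume_eq_smul_haarAddCircle, smul_smul,
    ENNReal.inv_mul_cancel (by simp [Real.pi_pos]) ENNReal.ofReal_ne_top, one_smul]

theorem integral_haarAddCircle {F : Circ → ℂ}
    (hF : AEStronglyMeasurable F AddCircle.haarAddCircle) :
    ∫ t, F t ∂AddCircle.haarAddCircle = ∫ x : ℝ, F (x : Circ) ∂intervalMeasure := by
  have h := measurePreserving_coe_circ
  rw [← h.map_eq] at hF ⊢
  exact integral_map h.measurable.aemeasurable hF

/-- The Dirichlet kernel as a function of two variables. -/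
noncomputable def dirichletKernel (M : ℕ) (a b : ℝ) : ℂ :=
  ∑ n ∈ Finset.Icc (-(M : ℤ)) (M : ℤ),
    Complex.exp (Complex.I * (n * b)) * Complex.exp (-(Complex.I * (n * a)))

theorem ae_liftIoc_eq (g : ℝ → ℂ) :
    ∀ᵐ x : ℝ ∂intervalMeasure, AddCircle.liftIoc (2 * Real.pi) 0 g (x : Circ) = g x := by
  have h : ∀ᵐ x : ℝ ∂volume.restrict (Icc 0 (2 * Real.pi)),
      AddCircle.liftIoc (2 * Real.pi) 0 g (x : Circ) = g x := by
    rw [← Measure.restrict_congr_set Ioc_ae_eq_Icc]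
    refine (ae_restrict_mem measurableSet_Ioc).mono fun x hx => ?_
    exact AddCircle.liftIoc_coe_apply (by simpa using hx)
  exact Measure.ae_smul_measure h _

theorem aestronglyMeasurable_liftIoc {g : ℝ → ℂ} (hg : Measurable g) :
    AEStronglyMeasurable (AddCircle.liftIoc (2 * Real.pi) 0 g) AddCircle.haarAddCircle := by
  refine Measurable.aestronglyMeasurable ?_
  exact (hg.comp measurable_subtype_coe).comp (AddCircle.measurableEquivIoc _ 0).measurable

theorem eLpNorm_liftIoc {g : ℝ → ℂ} (hg : Measurable g) (q : ℝ≥0∞) :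
    eLpNorm (AddCircle.liftIoc (2 * Real.pi) 0 g) q AddCircle.haarAddCircle =
      eLpNorm g q intervalMeasure := by
  rw [← eLpNorm_comp_measurePreserving (aestronglyMeasurable_liftIoc hg)
    measurePreserving_coe_circ]
  exact eLpNorm_congr_ae (ae_liftIoc_eq g)

theorem integral_dirichletKernel_mul {g : ℝ → ℂ} (hg : Measurable g)
    (hi : Integrable g intervalMeasure) (M : ℕ) (a : ℝ) :
    ∫ b, dirichletKernel M a b * g b ∂intervalMeasure =
      circleSum M (AddCircle.liftIoc (2 * Real.pi) 0 g) (a : Circ) := by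
  have hc : ∀ n : ℤ, ∫ b, Complex.exp (Complex.I * (n * b)) * g b ∂intervalMeasure =
      fourierCoeff (AddCircle.liftIoc (2 * Real.pi) 0 g) (-n) := by
    intro n
    have hf : AEStronglyMeasurable (fun t : Circ => (fourier n t : ℂ)) AddCircle.haarAddCircle :=
      (fourier n).continuous.aestronglyMeasurable
    have hm : AEStronglyMeasurable (fun t : Circ => (fourier n t : ℂ) *
        AddCircle.liftIoc (2 * Real.pi) 0 g t) AddCircle.haarAddCircle :=
      hf.mul (aestronglyMeasurable_liftIoc hg)
    simp only [fourierCoeff, neg_neg, smul_eq_mul]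
    rw [integral_haarAddCircle hm]
    refine integral_congr_ae ?_
    filter_upwards [ae_liftIoc_eq g] with x hx
    rw [hx, fourier_coe_two_pi]
  have hint : ∀ n : ℤ, Integrable (fun b : ℝ => Complex.exp (Complex.I * (n * b)) * g b)
      intervalMeasure := fun n => by
    refine hi.bdd_mul (c := 1) (Continuous.aestronglyMeasurable (by fun_prop))
      (Eventually.of_forall fun b => ?_)
    rw [show Complex.I * ((n : ℂ) * b) = ((n * b : ℝ) : ℂ) * Complex.I by push_cast; ring,
      Complex.norm_exp_ofReal_mul_I]
  have h1 : ∀ b : ℝ, dirichletKernel M a b * g b = ∑ n ∈ Finset.Icc (-(M : ℤ)) (M : ℤ),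
      Complex.exp (-(Complex.I * (n * a))) * (Complex.exp (Complex.I * (n * b)) * g b) := fun b => by
    rw [dirichletKernel, Finset.sum_mul]
    exact Finset.sum_congr rfl fun n _ => by ring
  simp only [h1]
  rw [integral_finsetSum _ fun n _ => (hint n).const_mul _]
  simp only [integral_const_mul, hc, circleSum]
  -- The kernel integrates against `e^{inb}`, whereas `fourierCoeff` uses `e^{-int}`; reflecting the
  -- symmetric window reconciles the two conventions.
  refine Finset.sum_nbij' (fun n => -n) (fun n => -n) ?_ ?_ ?_ ?_ ?_
  · intro n; simp only [Finset.mem_Icc]; omega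
  · intro n; simp only [Finset.mem_Icc]; omega
  · intro n _; exact neg_neg n
  · intro n _; exact neg_neg n
  · intro n _
    rw [fourier_coe_two_pi, mul_comm]
    congr 2; push_cast; ring

/-- Uniform `L^p` bound for one-dimensional Fourier partial sums, with a constant of order `p`. -/
theorem lintegral_dirichletKernel_le {p : ℝ} (hp : 6 ≤ p) (M : ℕ) {g : ℝ → ℂ}
    (hg : Measurable g) :
    ∫⁻ a, ‖∫ b, dirichletKernel M a b * g b ∂intervalMeasure‖ₑ ^ p ∂intervalMeasure ≤
      ENNReal.ofReal (6 * p) ^ p * ∫⁻ b, ‖g b‖ₑ ^ p ∂intervalMeasure := by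
  have hp0 : 0 < p := by linarith
  have hq0 : ENNReal.ofReal p ≠ 0 := by simpa using hp0
  have hq : 1 ≤ ENNReal.ofReal p := by
    rw [← ENNReal.ofReal_one]; exact ENNReal.ofReal_le_ofReal (by linarith)
  have hpow : ∀ {h : ℝ → ℂ}, ∫⁻ b, ‖h b‖ₑ ^ p ∂intervalMeasure =
      eLpNorm h (ENNReal.ofReal p) intervalMeasure ^ p := fun {h} => by
    rw [eLpNorm_eq_lintegral_rpow_enorm_toReal hq0 ENNReal.ofReal_ne_top,
      ENNReal.toReal_ofReal hp0.le, ← ENNReal.rpow_mul, one_div_mul_cancel hp0.ne',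
      ENNReal.rpow_one]
  rw [hpow, hpow, ← ENNReal.mul_rpow_of_nonneg _ _ hp0.le]
  -- Functions outside `L^p` are allowed, since the tensor induction applies the bound to slices
  -- known only to be measurable.
  by_cases htop : eLpNorm g (ENNReal.ofReal p) intervalMeasure = ∞
  · rw [htop, ENNReal.mul_top (by simpa using hp0), ENNReal.top_rpow_of_pos hp0]; exact le_top
  have hmem : MemLp g (ENNReal.ofReal p) intervalMeasure :=
    ⟨hg.aestronglyMeasurable, lt_top_iff_ne_top.2 htop⟩
  have hL : MemLp (AddCircle.liftIoc (2 * Real.pi) 0 g) (ENNReal.ofReal p)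
      AddCircle.haarAddCircle :=
    ⟨aestronglyMeasurable_liftIoc hg, by rw [eLpNorm_liftIoc hg]; exact hmem.2⟩
  gcongr
  simp only [integral_dirichletKernel_mul hg (hmem.integrable hq)]
  have := eLpNorm_circleSum_le M hp hL
  rw [eLpNorm_liftIoc hg, ← eLpNorm_comp_measurePreserving
    (continuous_circleSum M _).aestronglyMeasurable measurePreserving_coe_circ] at this
  exact this

/-! ### Tensor products of integral operators -/

/-- The integral operator on `ℝ^d` with kernel `∏ j, K (x j) (y j)`. -/
noncomputable def tensorOp (ν : Measure ℝ) (K : ℝ → ℝ → ℂ) {d : ℕ} (f : (Fin d → ℝ) → ℂ)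
    (x : Fin d → ℝ) : ℂ :=
  ∫ y, (∏ j, K (x j) (y j)) * f y ∂(Measure.pi fun _ => ν)

section
variable {ν : Measure ℝ} [IsProbabilityMeasure ν] {K : ℝ → ℝ → ℂ} {κ : ℝ}

theorem continuous_prod_kernel (hK : Continuous (Function.uncurry K)) (d : ℕ) :
    Continuous fun z : (Fin d → ℝ) × (Fin d → ℝ) => ∏ j, K (z.1 j) (z.2 j) :=
  continuous_finsetProd _ fun j _ =>
    hK.comp (by fun_prop : Continuous fun z : (Fin d → ℝ) × (Fin d → ℝ) => (z.1 j, z.2 j))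

theorem norm_prod_kernel_le (hκ : ∀ a b, ‖K a b‖ ≤ κ) {d : ℕ} (x y : Fin d → ℝ) :
    ‖∏ j, K (x j) (y j)‖ ≤ κ ^ d := by
  rw [norm_prod]
  calc _ ≤ ∏ _j : Fin d, κ := Finset.prod_le_prod (fun j _ => norm_nonneg _) fun j _ => hκ _ _
    _ = _ := by simp

theorem measurable_tensorOp_param (hK : Continuous (Function.uncurry K)) {d : ℕ}
    {u : ℝ → (Fin d → ℝ) → ℂ} (hu : Measurable (Function.uncurry u)) :
    Measurable fun z : ℝ × (Fin d → ℝ) => tensorOp ν K (u z.1) z.2 := by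
  have h : StronglyMeasurable fun w : (ℝ × (Fin d → ℝ)) × (Fin d → ℝ) =>
      (∏ j, K (w.1.2 j) (w.2 j)) * u w.1.1 w.2 := by
    refine (Measurable.mul ?_ ?_).stronglyMeasurable
    · exact ((continuous_prod_kernel hK d).comp
        (by fun_prop : Continuous fun w : (ℝ × (Fin d → ℝ)) × (Fin d → ℝ) =>
          (w.1.2, w.2))).measurable
    · exact hu.comp (by fun_prop : Measurable fun w : (ℝ × (Fin d → ℝ)) × (Fin d → ℝ) =>
          (w.1.1, w.2))
  exact h.integral_prod_right.measurable

/-- Fubini in the first coordinate, legitimate because the kernel is bounded and `f` integrable. -/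
theorem tensorOp_succ (hK : Continuous (Function.uncurry K)) (hκ : ∀ a b, ‖K a b‖ ≤ κ) {d : ℕ}
    {f : (Fin (d + 1) → ℝ) → ℂ} (hi : Integrable f (Measure.pi fun _ => ν))
    (a : ℝ) (x : Fin d → ℝ) :
    tensorOp ν K f (Fin.cons a x) =
      ∫ b, K a b * tensorOp ν K (fun y => f (Fin.cons b y)) x ∂ν := by
  have he := measurePreserving_piFinSuccAbove (fun _ : Fin (d + 1) => ν) 0
  have hes := he.symm
  have hsymm : ∀ z : ℝ × (Fin d → ℝ),
      (MeasurableEquiv.piFinSuccAbove (fun _ : Fin (d + 1) => ℝ) 0).symm z =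
        Fin.cons z.1 z.2 := fun z => by
    rw [← Fin.insertNth_zero']; rfl
  have hiu : Integrable (fun z : ℝ × (Fin d → ℝ) => f (Fin.cons z.1 z.2))
      (ν.prod (Measure.pi fun _ => ν)) := by
    have := (hes.integrable_comp_emb (MeasurableEquiv.measurableEmbedding _)).2 hi
    simpa only [Function.comp_def, hsymm] using this
  rw [tensorOp, ← hes.integral_comp' ]
  simp only [hsymm]
  have hint : Integrable (fun z : ℝ × (Fin d → ℝ) => (∏ j, K ((Fin.cons a x : Fin (d + 1) → ℝ) j)
      ((Fin.cons z.1 z.2 : Fin (d + 1) → ℝ) j)) * f (Fin.cons z.1 z.2))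
      (ν.prod (Measure.pi fun _ => ν)) := by
    refine hiu.bdd_mul (c := κ ^ (d + 1)) (Continuous.aestronglyMeasurable ?_)
      (Eventually.of_forall fun z => norm_prod_kernel_le hκ _ _)
    simp only [Fin.prod_univ_succ, Fin.cons_zero, Fin.cons_succ]
    refine Continuous.mul ?_ ?_
    · exact hK.comp (continuous_const.prodMk continuous_fst)
    · exact (continuous_prod_kernel hK d).comp (continuous_const.prodMk continuous_snd)
  have hp := integral_prod _ hint
  refine hp.trans (integral_congr_ae (Eventually.of_forall fun b => ?_))
  simp only [Fin.prod_univ_succ, Fin.cons_zero, Fin.cons_succ, mul_assoc, tensorOp]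
  rw [integral_const_mul]

/-- Induction on the dimension: the one-dimensional bound acts in the first variable with the others
frozen, then the induction hypothesis acts on slices of `f`. Each coordinate contributes one factor
`B`. -/
theorem lintegral_tensorOp_le (hK : Continuous (Function.uncurry K)) (hκ : ∀ a b, ‖K a b‖ ≤ κ)
    {p : ℝ} {B : ℝ≥0∞}
    (h : ∀ g : ℝ → ℂ, Measurable g →
      ∫⁻ a, ‖∫ b, K a b * g b ∂ν‖ₑ ^ p ∂ν ≤ B * ∫⁻ b, ‖g b‖ₑ ^ p ∂ν) (d : ℕ)
    {f : (Fin d → ℝ) → ℂ} (hf : Measurable f) (hi : Integrable f (Measure.pi fun _ => ν)) :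
    ∫⁻ x, ‖tensorOp ν K f x‖ₑ ^ p ∂(Measure.pi fun _ => ν) ≤
      B ^ d * ∫⁻ x, ‖f x‖ₑ ^ p ∂(Measure.pi fun _ => ν) := by
  induction d with
  | zero =>
    have hc : f = fun _ => f 0 := funext fun x => congrArg f (Subsingleton.elim _ _)
    rw [hc]; simp [tensorOp]
  | succ d ih =>
    have he := measurePreserving_piFinSuccAbove (fun _ : Fin (d + 1) => ν) 0
    have hes := he.symm
    have hsymm : ∀ z : ℝ × (Fin d → ℝ),
        (MeasurableEquiv.piFinSuccAbove (fun _ : Fin (d + 1) => ℝ) 0).symm z =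
          Fin.cons z.1 z.2 := fun z => by
      rw [← Fin.insertNth_zero']; rfl
    have mcons : Measurable fun z : ℝ × (Fin d → ℝ) => (Fin.cons z.1 z.2 : Fin (d + 1) → ℝ) := by
      have := (MeasurableEquiv.piFinSuccAbove (fun _ : Fin (d + 1) => ℝ) 0).symm.measurable
      rwa [funext hsymm] at this
    have mf : Measurable fun z : ℝ × (Fin d → ℝ) => f (Fin.cons z.1 z.2) := hf.comp mcons
    have mu : Measurable (Function.uncurry fun (b : ℝ) (y : Fin d → ℝ) => f (Fin.cons b y)) :=
      hf.comp mcons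
    have hiu : Integrable (fun z : ℝ × (Fin d → ℝ) => f (Fin.cons z.1 z.2))
        (ν.prod (Measure.pi fun _ => ν)) := by
      have := (hes.integrable_comp_emb (MeasurableEquiv.measurableEmbedding _)).2 hi
      simpa only [Function.comp_def, hsymm] using this
    have mh := measurable_tensorOp_param (ν := ν) hK mu
    have mS : Measurable fun z : ℝ × (Fin d → ℝ) =>
        ∫ b, K z.1 b * tensorOp ν K (fun y => f (Fin.cons b y)) z.2 ∂ν := by
      have : StronglyMeasurable fun w : (ℝ × (Fin d → ℝ)) × ℝ =>
          K w.1.1 w.2 * tensorOp ν K (fun y => f (Fin.cons w.2 y)) w.1.2 := by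
        refine (Measurable.mul ?_ ?_).stronglyMeasurable
        · exact (hK.comp (by fun_prop : Continuous fun w : (ℝ × (Fin d → ℝ)) × ℝ =>
            (w.1.1, w.2))).measurable
        · exact mh.comp (by fun_prop : Measurable fun w : (ℝ × (Fin d → ℝ)) × ℝ =>
            (w.2, w.1.2))
      exact this.integral_prod_right.measurable
    have change : ∀ F : (Fin (d + 1) → ℝ) → ℝ≥0∞,
        ∫⁻ x, F x ∂(Measure.pi fun _ => ν) =
          ∫⁻ z, F (Fin.cons z.1 z.2) ∂(ν.prod (Measure.pi fun _ => ν)) := fun F => by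
      rw [← hes.lintegral_comp_emb (MeasurableEquiv.measurableEmbedding _)]
      simp only [hsymm]
    rw [change, change]
    simp only [tensorOp_succ hK hκ hi]
    rw [lintegral_prod_symm _ (mS.enorm.pow_const p).aemeasurable,
      lintegral_prod _ (mf.enorm.pow_const p).aemeasurable]
    calc _ ≤ ∫⁻ x, B * ∫⁻ b, ‖tensorOp ν K (fun y => f (Fin.cons b y)) x‖ₑ ^ p ∂ν
          ∂(Measure.pi fun _ => ν) := lintegral_mono fun x =>
            h _ (mh.comp (by fun_prop : Measurable fun b : ℝ => (b, x)))
      _ = B * ∫⁻ b, ∫⁻ x, ‖tensorOp ν K (fun y => f (Fin.cons b y)) x‖ₑ ^ p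
          ∂(Measure.pi fun _ => ν) ∂ν := by
          have m2 := mh.enorm.pow_const p
          rw [lintegral_const_mul _ m2.lintegral_prod_left',
            ← lintegral_prod_symm _ m2.aemeasurable, lintegral_prod _ m2.aemeasurable]
      _ ≤ B * ∫⁻ b, B ^ d * ∫⁻ x, ‖f (Fin.cons b x)‖ₑ ^ p ∂(Measure.pi fun _ => ν) ∂ν := by
          gcongr 1
          -- Slices of an integrable function are integrable only almost everywhere.
          refine lintegral_mono_ae ?_
          filter_upwards [hiu.prod_right_ae] with b hb
          exact ih (mu.comp (by fun_prop : Measurable fun y : Fin d → ℝ => (b, y))) hb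
      _ = _ := by
          rw [lintegral_const_mul _ (mf.enorm.pow_const p).lintegral_prod_right',
            ← mul_assoc, ← pow_succ']

end

/-! ### Cubic partial sums -/

theorem torusMeasure_eq_pi (d : ℕ) :
    torusMeasure d = Measure.pi fun _ : Fin d => intervalMeasure := by
  refine (Measure.pi_eq fun s _ => ?_).symm
  have hIcc : Icc (0 : Fin d → ℝ) (fun _ => 2 * Real.pi) =
      univ.pi fun _ => Icc 0 (2 * Real.pi) := by
    ext x; simp [Pi.le_def]
  rw [torusMeasure, hIcc, volume_pi, Measure.restrict_pi_pi, Measure.smul_apply, Measure.pi_pi]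
  simp only [intervalMeasure, Measure.smul_apply, smul_eq_mul, Finset.prod_mul_distrib,
    Finset.prod_const, Finset.card_univ, Fintype.card_fin]
  rw [ENNReal.ofReal_pow (by positivity), ENNReal.inv_pow]

instance (d : ℕ) : IsProbabilityMeasure (torusMeasure d) := by
  rw [torusMeasure_eq_pi]; infer_instance

theorem continuous_dirichletKernel (M : ℕ) :
    Continuous (Function.uncurry (dirichletKernel M)) := by
  simp only [Function.uncurry_def, dirichletKernel]; fun_prop

theorem norm_dirichletKernel_le (M : ℕ) (a b : ℝ) :
    ‖dirichletKernel M a b‖ ≤ (Finset.Icc (-(M : ℤ)) (M : ℤ)).card := by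
  refine (norm_sum_le _ _).trans ?_
  have : ∀ n ∈ Finset.Icc (-(M : ℤ)) (M : ℤ), ‖Complex.exp (Complex.I * (n * b)) *
      Complex.exp (-(Complex.I * (n * a)))‖ ≤ 1 := fun n _ => by
    rw [← Complex.exp_add, show Complex.I * ((n : ℂ) * b) + -(Complex.I * (n * a)) =
      ((n * b - n * a : ℝ) : ℂ) * Complex.I by push_cast; ring, Complex.norm_exp_ofReal_mul_I]
  refine (Finset.sum_le_card_nsmul _ _ _ this).trans ?_
  simp

/-- The frequency set is a product of intervals, so the sum of exponentials over it factors into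
one-dimensional Dirichlet kernels. -/
theorem partialSum_eq_tensorOp {d : ℕ} (M : ℕ) {f : (Fin d → ℝ) → ℂ}
    (hi : Integrable f (torusMeasure d)) (x : Fin d → ℝ) :
    partialSum M f x = tensorOp intervalMeasure (dirichletKernel M) f x := by
  have hint : ∀ n : Fin d → ℤ, Integrable (fun y : Fin d → ℝ =>
      Complex.exp (Complex.I * ∑ j, (n j : ℂ) * (y j : ℂ)) * f y) (torusMeasure d) := fun n => by
    refine hi.bdd_mul (c := 1) (Continuous.aestronglyMeasurable (by fun_prop))
      (Eventually.of_forall fun y => ?_)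
    rw [show Complex.I * ∑ j, (n j : ℂ) * (y j : ℂ) =
      ((∑ j, (n j : ℝ) * y j : ℝ) : ℂ) * Complex.I by push_cast; ring,
      Complex.norm_exp_ofReal_mul_I]
  simp only [partialSum, fourierCoef, tensorOp, ← torusMeasure_eq_pi, ← integral_mul_const]
  rw [← integral_finsetSum _ fun n _ => (hint n).mul_const _]
  refine integral_congr_ae (Eventually.of_forall fun y => ?_)
  simp only [dirichletKernel, Finset.prod_univ_sum, Finset.sum_mul]
  refine Finset.sum_congr rfl fun n _ => ?_
  rw [Finset.prod_mul_distrib, ← Complex.exp_sum, ← Complex.exp_sum, Finset.sum_neg_distrib,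
    ← Finset.mul_sum, ← Finset.mul_sum]
  ring

theorem continuous_partialSum {d : ℕ} (M : ℕ) (f : (Fin d → ℝ) → ℂ) :
    Continuous (partialSum M f) := by
  unfold partialSum; fun_prop

theorem partialSum_congr_ae {d : ℕ} (M : ℕ) {f g : (Fin d → ℝ) → ℂ}
    (h : f =ᵐ[torusMeasure d] g) : partialSum M f = partialSum M g := by
  have : ∀ n, fourierCoef f n = fourierCoef g n := fun n =>
    integral_congr_ae (h.mono fun x hx => by simp only [hx])
  ext x; simp only [partialSum, this]

/-- Uniform `L^p` bound for cubic partial sums, with a constant of order `p ^ d`. -/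
theorem lintegral_partialSum_le {p : ℝ} (hp : 6 ≤ p) {d : ℕ} (M : ℕ) {f : (Fin d → ℝ) → ℂ}
    (hi : Integrable f (torusMeasure d)) :
    ∫⁻ x, ‖partialSum M f x‖ₑ ^ p ∂(torusMeasure d) ≤
      (ENNReal.ofReal (6 * p) ^ p) ^ d * ∫⁻ x, ‖f x‖ₑ ^ p ∂(torusMeasure d) := by
  obtain ⟨g, hg, hfg⟩ := hi.1
  have hgi := hi.congr hfg
  have hr : ∫⁻ x, ‖f x‖ₑ ^ p ∂(torusMeasure d) = ∫⁻ x, ‖g x‖ₑ ^ p ∂(torusMeasure d) :=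
    lintegral_congr_ae (hfg.mono fun x hx => by simp only [hx])
  rw [partialSum_congr_ae M hfg, hr]
  simp only [partialSum_eq_tensorOp M hgi]
  rw [torusMeasure_eq_pi] at hgi ⊢
  exact lintegral_tensorOp_le (continuous_dirichletKernel M) (norm_dirichletKernel_le M)
    (fun g hg => lintegral_dirichletKernel_le hp M hg) d hg.measurable hgi

/-! ### The class `Ψ` and the Legendre transform -/

section
variable {α : ℝ} {ψ : ℝ → ℝ}

theorem ClassPsi.pos_of_le (h : ClassPsi α ψ) {p : ℝ} (hp : α ≤ p) : 0 < ψ p :=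
  h.pos.trans_le (h.strictMonoOn.monotoneOn self_mem_Ici hp hp)

theorem ClassPsi.mono_left (h : ClassPsi α ψ) {β : ℝ} (hβ : α ≤ β) : ClassPsi β ψ where
  one_le := h.one_le.trans hβ
  continuousOn := h.continuousOn.mono (Ici_subset_Ici.2 hβ)
  pos := h.pos_of_le hβ
  strictMonoOn := h.strictMonoOn.mono (Ici_subset_Ici.2 hβ)
  convexOn := h.convexOn.subset (Ici_subset_Ici.2 hβ) (convex_Ici β)
  tendsto := h.tendsto

theorem mul_log_psiPow (d : ℕ) {p : ℝ} (hp : 0 < p) (hψ : 0 < ψ p) :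
    p * Real.log (psiPow d ψ p) = d * (p * Real.log p) + p * Real.log (ψ p) := by
  rw [psiPow, Real.log_mul (by positivity) hψ.ne', Real.log_pow]; ring

theorem ClassPsi.psiPow (h : ClassPsi α ψ) (d : ℕ) : ClassPsi α (psiPow d ψ) where
  one_le := h.one_le
  continuousOn := (continuous_pow d).continuousOn.mul h.continuousOn
  pos := mul_pos (pow_pos (by linarith [h.one_le]) d) h.pos
  strictMonoOn := fun x hx y hy hxy => by
    have h1 : 1 ≤ x := h.one_le.trans hx
    refine mul_lt_mul' (pow_le_pow_left₀ (by linarith) hxy.le d) (h.strictMonoOn hx hy hxy)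
      (h.pos_of_le hx).le (pow_pos (by linarith) d)
  convexOn := by
    have h1 : ConvexOn ℝ (Ici α) fun p : ℝ => (d : ℝ) * (p * Real.log p) :=
      ((Real.convexOn_mul_log.subset (Ici_subset_Ici.2 (by linarith [h.one_le]))
        (convex_Ici α))).smul (Nat.cast_nonneg d)
    refine (h1.add h.convexOn).congr fun p hp => ?_
    have hp1 : 1 ≤ p := h.one_le.trans hp
    exact (mul_log_psiPow d (by linarith) (h.pos_of_le hp)).symm
  tendsto := by
    refine tendsto_atTop_mono' atTop ?_ h.tendsto
    filter_upwards [eventually_ge_atTop α] with p hp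
    have hp1 : 1 ≤ p := h.one_le.trans hp
    exact le_mul_of_one_le_left (h.pos_of_le hp).le (one_le_pow₀ hp1)

theorem ClassPsi.continuousOn_mul_log (h : ClassPsi α ψ) :
    ContinuousOn (fun p => p * Real.log (ψ p)) (Ici α) :=
  continuousOn_id.mul (h.continuousOn.log fun _ hp => (h.pos_of_le hp).ne')

theorem ClassPsi.concaveOn_sub (h : ClassPsi α ψ) (y : ℝ) :
    ConcaveOn ℝ (Ici α) fun p => p * y - p * Real.log (ψ p) := by
  have : ConcaveOn ℝ (Ici α) fun p : ℝ => p * y := by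
    refine ⟨convex_Ici α, fun a _ b _ s t _ _ _ => le_of_eq ?_⟩
    simp only [smul_eq_mul]; ring
  exact this.sub h.convexOn

theorem ClassPsi.exists_isMaxOn (h : ClassPsi α ψ) (y : ℝ) :
    ∃ q, α ≤ q ∧ ∀ p, α ≤ p → p * y - p * Real.log (ψ p) ≤ q * y - q * Real.log (ψ q) := by
  set g : ℝ → ℝ := fun p => p * y - p * Real.log (ψ p)
  have hg : ContinuousOn g (Ici α) :=
    (continuous_id.mul continuous_const).continuousOn.sub h.continuousOn_mul_log
  obtain ⟨R, hR⟩ := eventually_atTop.1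
    ((Real.tendsto_log_atTop.comp h.tendsto).eventually_ge_atTop (y + 1))
  -- Past `R` one has `g p ≤ -p`, so past `-g α` the value is at most `g α`, and the maximum over
  -- `[α, S]` is global.
  set S := max α (max R (-g α))
  obtain ⟨q, hq, hmax⟩ := isCompact_Icc.exists_isMaxOn (nonempty_Icc.2 (le_max_left α _ : α ≤ S))
    (hg.mono Icc_subset_Ici_self)
  refine ⟨q, hq.1, fun p hp => ?_⟩
  rcases le_total p S with hpS | hpS
  · exact hmax ⟨hp, hpS⟩
  · have h1 : y + 1 ≤ Real.log (ψ p) :=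
      hR p ((le_max_left R _).trans ((le_max_right α _).trans hpS))
    have h2 : -g α ≤ p := (le_max_right R _).trans ((le_max_right α _).trans hpS)
    have h3 : 1 ≤ p := h.one_le.trans hp
    have h4 : g α ≤ g q := hmax ⟨le_rfl, le_max_left α _⟩
    have h5 : g p ≤ -p := by
      have := mul_le_mul_of_nonneg_left h1 (by linarith : 0 ≤ p)
      simp only [g]; linarith
    change g p ≤ g q
    linarith

theorem ClassPsi.le_legendre (h : ClassPsi α ψ) (y : ℝ) {p : ℝ} (hp : α ≤ p) :
    p * y - p * Real.log (ψ p) ≤ legendre α ψ y :=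
  le_ciSup (h.bddAbove_legendre y) (⟨p, hp⟩ : Ici α)

theorem ClassPsi.exists_legendre_eq (h : ClassPsi α ψ) (y : ℝ) :
    ∃ q, α ≤ q ∧ legendre α ψ y = q * y - q * Real.log (ψ q) ∧
      ∀ p, α ≤ p → p * y - p * Real.log (ψ p) ≤ q * y - q * Real.log (ψ q) := by
  obtain ⟨q, hq, hmax⟩ := h.exists_isMaxOn y
  have : Nonempty (Ici α) := ⟨⟨α, self_mem_Ici⟩⟩
  exact ⟨q, hq, le_antisymm (ciSup_le fun p => hmax p p.2) (h.le_legendre y hq), hmax⟩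

end

/-! ### Discretisation of the exponent -/

/-- The failure of midpoint linearity of `φ` on `[a, b]`. -/
noncomputable def midDefect (φ : ℝ → ℝ) (a b : ℝ) : ℝ := (φ a + φ b) / 2 - φ ((a + b) / 2)

section
variable {β : ℝ} {φ : ℝ → ℝ}

/-- The defect vanishes at `b = a` and is continuous in `b`; either it stays at most `1` at `a + 1`,
or it takes the value `1` earlier. -/
theorem exists_step_midDefect (hφ : ContinuousOn φ (Ici β)) {a : ℝ} (ha : β ≤ a) :
    ∃ b, a < b ∧ b ≤ a + 1 ∧ midDefect φ a b ≤ 1 ∧ (b = a + 1 ∨ midDefect φ a b = 1) := by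
  by_cases h : midDefect φ a (a + 1) ≤ 1
  · exact ⟨a + 1, by linarith, le_rfl, h, Or.inl rfl⟩
  have h0 : midDefect φ a a = 0 := by simp [midDefect]
  have hc : ContinuousOn (fun b => midDefect φ a b) (Icc a (a + 1)) := by
    have h1 : ContinuousOn φ (Icc a (a + 1)) := hφ.mono fun x hx => ha.trans hx.1
    have h2 : ContinuousOn (fun b => φ ((a + b) / 2)) (Icc a (a + 1)) :=
      hφ.comp (by fun_prop) fun x hx => by
        have := hx.1; simp only [mem_Ici]; linarith
    exact ((continuousOn_const.add h1).div_const 2).sub h2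
  obtain ⟨b, hb, hb1⟩ := intermediate_value_Icc (by linarith : a ≤ a + 1) hc
    ⟨by rw [h0]; norm_num, (not_le.1 h).le⟩
  refine ⟨b, lt_of_le_of_ne hb.1 ?_, hb.2, hb1.le, Or.inr hb1⟩
  rintro rfl
  simp only [h0] at hb1
  norm_num at hb1

theorem exists_seq_midDefect (hφ : ContinuousOn φ (Ici β)) :
    ∃ p : ℕ → ℝ, p 0 = β ∧ StrictMono p ∧ Tendsto p atTop atTop ∧
      ∀ n, p (n + 1) ≤ p n + 1 ∧ midDefect φ (p n) (p (n + 1)) ≤ 1 ∧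
        (p (n + 1) = p n + 1 ∨ midDefect φ (p n) (p (n + 1)) = 1) := by
  choose! next h1 h2 h3 h4 using fun a (ha : β ≤ a) => exists_step_midDefect hφ ha
  let p : ℕ → ℝ := fun n => next^[n] β
  have hs : ∀ n, p (n + 1) = next (p n) := fun n => Function.iterate_succ_apply' next n β
  have hβ : ∀ n, β ≤ p n := fun n => by
    induction n with
    | zero => exact le_rfl
    | succ n ih => rw [hs]; exact ih.trans (h1 _ ih).le
  have hmono : StrictMono p := strictMono_nat_of_lt_succ fun n => by
    rw [hs]; exact h1 _ (hβ n)
  have hstep : ∀ n, p (n + 1) ≤ p n + 1 ∧ midDefect φ (p n) (p (n + 1)) ≤ 1 ∧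
      (p (n + 1) = p n + 1 ∨ midDefect φ (p n) (p (n + 1)) = 1) := fun n => by
    rw [hs]; exact ⟨h2 _ (hβ n), h3 _ (hβ n), h4 _ (hβ n)⟩
  refine ⟨p, rfl, hmono, ?_, hstep⟩
  rcases tendsto_atTop_of_monotone hmono.monotone with h | ⟨l, hl⟩
  · exact h
  -- At a finite limit both the step length and the defect would tend to `0`, yet at every step one
  -- of them equals `1`.
  exfalso
  have hlβ : β ≤ l := ge_of_tendsto' hl hβ
  have hl1 := hl.comp (tendsto_add_atTop_nat 1)
  have comp : ∀ u : ℕ → ℝ, Tendsto u atTop (nhds l) → (∀ n, β ≤ u n) →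
      Tendsto (fun n => φ (u n)) atTop (nhds (φ l)) := fun u hu hb =>
    (hφ l hlβ).tendsto.comp (tendsto_nhdsWithin_iff.2 ⟨hu, Eventually.of_forall hb⟩)
  have hmid : Tendsto (fun n => (p n + p (n + 1)) / 2) atTop (nhds l) := by
    have := (hl.add hl1).div_const 2
    rwa [show (l + l) / 2 = l by ring] at this
  have hδ : Tendsto (fun n => midDefect φ (p n) (p (n + 1))) atTop (nhds 0) := by
    have := (((comp p hl hβ).add (comp _ hl1 fun n => hβ (n + 1))).div_const 2).sub
      (comp _ hmid fun n => by linarith [hβ n, hβ (n + 1)])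
    rwa [show (φ l + φ l) / 2 - φ l = 0 by ring] at this
  have hd : Tendsto (fun n => p (n + 1) - p n) atTop (nhds 0) := by
    have := hl1.sub hl
    rwa [sub_self] at this
  obtain ⟨n, hn1, hn2⟩ := ((hδ.eventually_lt_const one_pos).and
    (hd.eventually_lt_const one_pos)).exists
  rcases (hstep n).2.2 with h | h
  · linarith
  · linarith

end

section
variable {β : ℝ} {g : ℝ → ℝ}

/-- The midpoint is a convex combination of `q` and the endpoint on the other side, with weight `l ≥
1/2` on `q`. Concavity thus bounds `g q` by the maximum plus `1 / l ≤ 2`. -/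
theorem ConcaveOn.le_max_add_two (hg : ConcaveOn ℝ (Ici β) g) {a b q : ℝ} (ha : β ≤ a)
    (hab : a < b) (hq : q ∈ Icc a b) (hm : g ((a + b) / 2) ≤ (g a + g b) / 2 + 1) :
    g q ≤ max (g a) (g b) + 2 := by
  have hA := le_max_left (g a) (g b)
  have hB := le_max_right (g a) (g b)
  set X := max (g a) (g b)
  have aux : ∀ c e : ℝ, β ≤ c → g e ≤ X → g c ≤ X → q ≠ c →
      (∃ l : ℝ, 1 / 2 ≤ l ∧ l ≤ 1 ∧ l * q + (1 - l) * c = (a + b) / 2) →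
      g a + g b = g e + g c → g q ≤ X + 2 := by
    rintro c e hc he hcX - ⟨l, hl, hl1, heq⟩ hsum
    have h1 := hg.2 (mem_Ici.2 (ha.trans hq.1)) (mem_Ici.2 hc) (by linarith : 0 ≤ l)
      (by linarith : 0 ≤ 1 - l) (by ring)
    simp only [smul_eq_mul, heq] at h1
    have h2 : (l - 1 / 2) * g c ≤ (l - 1 / 2) * X :=
      mul_le_mul_of_nonneg_left hcX (by linarith)
    have h3 : l * g q ≤ l * (X + 2) := by linarith
    exact le_of_mul_le_mul_left h3 (by linarith)
  rcases le_total q ((a + b) / 2) with h | h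
  · have hbq : 0 < b - q := by linarith
    refine aux b a (by linarith) hA hB (by linarith) ⟨(b - a) / 2 / (b - q), ?_, ?_, ?_⟩ rfl
    · rw [le_div_iff₀ hbq]; linarith [hq.1]
    · rw [div_le_one hbq]; linarith
    · field_simp; ring
  · have hbq : 0 < q - a := by linarith
    refine aux a b ha hB hA (by linarith) ⟨(b - a) / 2 / (q - a), ?_, ?_, ?_⟩ (add_comm _ _)
    · rw [le_div_iff₀ hbq]; linarith [hq.2]
    · rw [div_le_one hbq]; linarith
    · field_simp; ring

theorem sum_exp_le_four_mul (hg : ConcaveOn ℝ (Ici β) g) (hβ : 1 ≤ β) {q : ℝ} (hq : β ≤ q)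
    (hmax : ∀ p, β ≤ p → g p ≤ g q) {p : ℕ → ℝ} (hp0 : p 0 = β) (hp : StrictMono p)
    (hstep : ∀ n, p (n + 1) = p n + 1 ∨
      g ((p n + p (n + 1)) / 2) = (g (p n) + g (p (n + 1))) / 2 + 1) (n : ℕ) :
    ∑ j ∈ Finset.range n, Real.exp (g (p j) - p j) ≤ 4 * Real.exp (g q) := by
  have hpβ : ∀ n, β ≤ p n := fun n => hp0 ▸ hp.monotone (Nat.zero_le n)
  have hlt : ∀ n, p n < p (n + 1) := fun n => hp (Nat.lt_succ_self n)
  have e1 : Real.exp (-1) ≤ 1 / 2 := by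
    rw [Real.exp_neg, ← one_div]
    exact one_div_le_one_div_of_le two_pos (by linarith [Real.add_one_le_exp (1 : ℝ)])
  have e2 : Real.exp (-2) ≤ 1 / 4 := by
    have : Real.exp (-2) = Real.exp (-1) * Real.exp (-1) := by rw [← Real.exp_add]; norm_num
    rw [this]
    nlinarith [Real.exp_pos (-1)]
  have up : ∀ x z, β ≤ x → x ≤ z → z ≤ q → g x ≤ g z := fun x z hx hxz hzq => by
    have := hg.min_le_of_mem_Icc (mem_Ici.2 hx) (mem_Ici.2 hq) ⟨hxz, hzq⟩
    rwa [min_eq_left (hmax x hx)] at this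
  have down : ∀ x z, q ≤ x → x ≤ z → g z ≤ g x := fun x z hx hxz => by
    have hz : β ≤ z := hq.trans (hx.trans hxz)
    have := hg.min_le_of_mem_Icc (mem_Ici.2 hq) (mem_Ici.2 hz) ⟨hx, hxz⟩
    rwa [min_eq_right (hmax z hz)] at this
  -- Left of the maximiser the sum is controlled by its endpoint value, the `-e^{-p_n}` leaving room
  -- for unit steps. Right of it the terms at least halve, and the extra copy of the last term is
  -- the budget for the remaining tail.
  have main : ∀ n, (p n ≤ q → ∑ j ∈ Finset.range (n + 1), Real.exp (g (p j) - p j) ≤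
        (2 - Real.exp (-p n)) * Real.exp (g (p n))) ∧
      (q < p n → ∑ j ∈ Finset.range (n + 1), Real.exp (g (p j) - p j) +
        Real.exp (g (p n) - p n) ≤ 4 * Real.exp (g q)) := by
    intro n
    induction n with
    | zero =>
      refine ⟨fun _ => ?_, fun h => absurd h (by rw [hp0]; exact not_lt.2 hq)⟩
      rw [zero_add, Finset.sum_range_one, sub_eq_add_neg, Real.exp_add, mul_comm]
      gcongr
      have : Real.exp (-p 0) ≤ 1 := Real.exp_le_one_iff.2 (by linarith [hpβ 0])
      linarith
    | succ n ih =>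
      have hn := hlt n
      have hbn := hpβ n
      set a := p n with ha
      set b := p (n + 1) with hb
      have hb1 : Real.exp (-b) ≤ 1 / 2 :=
        (Real.exp_le_exp.2 (by linarith : -b ≤ -1)).trans e1
      rw [Finset.sum_range_succ _ (n + 1)]
      refine ⟨fun hbq => ?_, fun hbq => ?_⟩
      · have hS := ih.1 (hn.le.trans hbq)
        have hx : Real.exp (g b - b) = Real.exp (-b) * Real.exp (g b) := by
          rw [← Real.exp_add]; congr 1; ring
        rw [hx]
        have hgb := Real.exp_pos (g b)
        rcases hstep n with h | h
        · have h1 : Real.exp (g a) ≤ Real.exp (g b) := Real.exp_le_exp.2 (up a b hbn hn.le hbq)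
          have h2 : 2 * Real.exp (-b) ≤ Real.exp (-a) := by
            have : Real.exp (-b) = Real.exp (-1) * Real.exp (-a) := by
              rw [← Real.exp_add]; congr 1; linarith
            rw [this]
            nlinarith [Real.exp_pos (-a)]
          have h3 : Real.exp (-a) ≤ 1 := Real.exp_le_one_iff.2 (by linarith)
          have h4 : (2 - Real.exp (-a)) * Real.exp (g a) ≤ (2 - Real.exp (-a)) * Real.exp (g b) :=
            mul_le_mul_of_nonneg_left h1 (by linarith)
          nlinarith
        -- A unit defect with `g` increasing up to `b` forces `g a ≤ g b - 2`, a geometric gain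
        -- without help from the weight.
        · have hmid := up ((a + b) / 2) b (by linarith) (by linarith) hbq
          have h1 : Real.exp (g a) ≤ Real.exp (-2) * Real.exp (g b) := by
            rw [← Real.exp_add]; exact Real.exp_le_exp.2 (by linarith)
          have h2 := Real.exp_pos (-a)
          nlinarith [Real.exp_pos (g a)]
      · by_cases haq : a ≤ q
        · have hS := ih.1 haq
          have h1 : Real.exp (g a) ≤ Real.exp (g q) := Real.exp_le_exp.2 (hmax a hbn)
          have h2 : Real.exp (g b - b) ≤ Real.exp (g q) :=
            Real.exp_le_exp.2 (by linarith [hmax b (by linarith)])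
          nlinarith [Real.exp_pos (-a), Real.exp_pos (g a)]
        · have haq' := (not_le.1 haq).le
          have hS := ih.2 (not_le.1 haq)
          have h1 : g b - b ≤ (g a - a) + -1 := by
            rcases hstep n with h | h
            · have := down a b haq' hn.le
              linarith
            · have := down a ((a + b) / 2) haq' (by linarith)
              linarith
          have h2 : Real.exp (g b - b) ≤ Real.exp (g a - a) * (1 / 2) := by
            refine (Real.exp_le_exp.2 h1).trans ?_
            rw [Real.exp_add]
            gcongr
          linarith
  have hpos := Real.exp_pos (g q)
  cases n with
  | zero => simp only [Finset.range_zero, Finset.sum_empty]; positivity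
  | succ n =>
    rcases le_or_gt (p n) q with h | h
    · have h1 := (main n).1 h
      have h2 : Real.exp (g (p n)) ≤ Real.exp (g q) := Real.exp_le_exp.2 (hmax _ (hpβ n))
      nlinarith [Real.exp_pos (-p n), Real.exp_pos (g (p n))]
    · have h1 := (main n).2 h
      have := Real.exp_pos (g (p n) - p n)
      linarith

end

/-- The exponential Orlicz functions generated by `ψ` and by `p ^ d ψ(p)` are simultaneously
comparable with sums of powers. -/
theorem ClassPsi.exists_discretisation {α : ℝ} {ψ : ℝ → ℝ} (h : ClassPsi α ψ) (d : ℕ) :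
    ∃ (p : ℕ → ℝ) (Y : ℝ), (∀ j, 6 ≤ p j ∧ α ≤ p j) ∧
      (∀ y, Y ≤ y → ENNReal.ofReal (Real.exp (legendre α (ExpOrlicz.psiPow d ψ) y)) ≤
        ENNReal.ofReal (Real.exp (2 + 2 * d)) * ∑' j, ENNReal.ofReal
          (Real.exp (p j * y - p j * Real.log (ExpOrlicz.psiPow d ψ (p j))))) ∧
      ∀ y, ∑' j, ENNReal.ofReal (Real.exp (p j * (y - 1) - p j * Real.log (ψ (p j)))) ≤
        ENNReal.ofReal (4 * Real.exp (legendre α ψ y)) := by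
  set β := max α 6
  have hαβ : α ≤ β := le_max_left _ _
  have h6 : 6 ≤ β := le_max_right _ _
  have hβ := h.mono_left hαβ
  have hd := h.psiPow d
  obtain ⟨p, hp0, hp, hpt, hstep⟩ := exists_seq_midDefect hβ.continuousOn_mul_log
  have hpβ : ∀ n, β ≤ p n := fun n => hp0 ▸ hp.monotone (Nat.zero_le n)
  refine ⟨p, (β + 1) * Real.log (ExpOrlicz.psiPow d ψ (β + 1)) -
    β * Real.log (ExpOrlicz.psiPow d ψ β) + 1, fun j => ⟨h6.trans (hpβ j), hαβ.trans (hpβ j)⟩,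
    fun y hy => ?_, fun y => ?_⟩
  · set G : ℝ → ℝ := fun q => q * y - q * Real.log (ExpOrlicz.psiPow d ψ q) with hG
    have hconc : ConcaveOn ℝ (Ici α) G := hd.concaveOn_sub y
    obtain ⟨q, hqβ, hq⟩ : ∃ q, β ≤ q ∧ legendre α (ExpOrlicz.psiPow d ψ) y ≤ G q := by
      obtain ⟨q, hqα, hqe, hqm⟩ := hd.exists_legendre_eq y
      rcases le_total β q with hle | hle
      · exact ⟨q, hle, hqe.le⟩
      refine ⟨β, le_rfl, hqe.le.trans ?_⟩
      -- The threshold on `y` was chosen for this inequality: if the maximiser lies left of `β`,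
      -- concavity forces `G β` to be at least the maximum.
      have h1 : G β < G (β + 1) := by simp only [hG]; linarith
      have h2 := hconc.min_le_of_mem_Icc (mem_Ici.2 hqα)
        (mem_Ici.2 (by linarith : α ≤ β + 1)) (⟨hle, by linarith⟩ : β ∈ Icc q (β + 1))
      rcases min_le_iff.1 h2 with h3 | h3
      · exact h3
      · linarith
    obtain ⟨j, hj, hj'⟩ : ∃ j, p j ≤ q ∧ q ≤ p (j + 1) := by
      have hex : ∃ n, q < p n := (hpt.eventually_gt_atTop q).exists
      have hn0 : Nat.find hex ≠ 0 := fun h0 => by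
        have := Nat.find_spec hex
        rw [h0, hp0] at this; linarith
      obtain ⟨j, hj⟩ := Nat.exists_eq_succ_of_ne_zero hn0
      refine ⟨j, not_lt.1 (Nat.find_min hex (by omega)), ?_⟩
      have := Nat.find_spec hex
      rw [hj] at this
      exact this.le
    set a := p j with ha
    set b := p (j + 1) with hb
    have haβ : β ≤ a := hpβ j
    have hab : a < b := hp (Nat.lt_succ_self j)
    have ha0 : 0 < a := by linarith
    obtain ⟨hb1, hδ, -⟩ := hstep j
    -- Freezing `log r` at `log a` turns the extra term `d r log r` into a linear one, so that the
    -- defect bound for `ψ` alone applies. On `[a, b]` with `b ≤ a + 1` the correction lies between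
    -- `0` and `2d`.
    set y' := y - d * Real.log a
    have key := ConcaveOn.le_max_add_two (hβ.concaveOn_sub y') haβ hab ⟨hj, hj'⟩ (by
      simp only [midDefect] at hδ
      linarith)
    have hGr : ∀ r, α ≤ r → 0 < r →
        G r = r * y' - r * Real.log (ψ r) - d * (r * (Real.log r - Real.log a)) :=
      fun r hr hr0 => by
        simp only [hG, y']; rw [mul_log_psiPow d hr0 (h.pos_of_le hr)]; ring
    have hGa := hGr a (by linarith) ha0
    have hGb := hGr b (by linarith) (by linarith)
    have hGq := hGr q (by linarith) (by linarith)
    rw [sub_self, mul_zero, mul_zero, sub_zero] at hGa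
    have hlq : 0 ≤ (d : ℝ) * (q * (Real.log q - Real.log a)) := by
      have := Real.log_le_log ha0 hj
      exact mul_nonneg (Nat.cast_nonneg d) (mul_nonneg (by linarith) (by linarith))
    have hlb : (d : ℝ) * (b * (Real.log b - Real.log a)) ≤ 2 * d := by
      have h1 : Real.log b - Real.log a ≤ 1 / a := by
        rw [← Real.log_div (by linarith) ha0.ne']
        refine (Real.log_le_sub_one_of_pos (div_pos (by linarith) ha0)).trans ?_
        rw [div_sub_one ha0.ne']
        gcongr
        linarith
      have h2 : b * (1 / a) ≤ 2 := by
        rw [mul_one_div, div_le_iff₀ ha0]; linarith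
      have h3 : b * (Real.log b - Real.log a) ≤ 2 :=
        (mul_le_mul_of_nonneg_left h1 (by linarith)).trans h2
      nlinarith [(Nat.cast_nonneg d : (0 : ℝ) ≤ d)]
    have hfin : G q ≤ max (G a) (G b) + (2 + 2 * d) := by
      have hd0 : (0 : ℝ) ≤ d := Nat.cast_nonneg d
      rcases le_max_iff.1 (sub_le_iff_le_add.2 key) with h1 | h1
      · have := le_max_left (G a) (G b); linarith
      · have := le_max_right (G a) (G b); linarith
    have hterm : ∃ i, G q ≤ G (p i) + (2 + 2 * d) := by
      rcases max_choice (G a) (G b) with h1 | h1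
      · exact ⟨j, by rw [h1] at hfin; exact hfin⟩
      · exact ⟨j + 1, by rw [h1] at hfin; exact hfin⟩
    obtain ⟨i, hi⟩ := hterm
    calc ENNReal.ofReal (Real.exp (legendre α (ExpOrlicz.psiPow d ψ) y))
        ≤ ENNReal.ofReal (Real.exp (2 + 2 * d) * Real.exp (G (p i))) := by
          rw [← Real.exp_add]
          exact ENNReal.ofReal_le_ofReal (Real.exp_le_exp.2 (by linarith))
      _ = ENNReal.ofReal (Real.exp (2 + 2 * d)) * ENNReal.ofReal (Real.exp (G (p i))) :=
          ENNReal.ofReal_mul (by positivity)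
      _ ≤ _ := by
          gcongr
          exact ENNReal.le_tsum (f := fun j => ENNReal.ofReal (Real.exp (G (p j)))) i
  · obtain ⟨q, hq, hmax⟩ := hβ.exists_isMaxOn y
    refine ENNReal.tsum_le_of_sum_range_le fun n => ?_
    rw [← ENNReal.ofReal_sum_of_nonneg fun _ _ => (Real.exp_pos _).le]
    refine ENNReal.ofReal_le_ofReal ?_
    have := sum_exp_le_four_mul (hβ.concaveOn_sub y) (by linarith) hq hmax hp0 hp (fun n => ?_) n
    · have h2 : Real.exp (q * y - q * Real.log (ψ q)) ≤ Real.exp (legendre α ψ y) :=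
        Real.exp_le_exp.2 (h.le_legendre y (hαβ.trans hq))
      refine le_trans (le_of_eq (Finset.sum_congr rfl fun j _ => ?_)) (this.trans (by linarith))
      congr 1; ring
    · refine (hstep n).2.2.imp id fun h1 => ?_
      simp only [midDefect] at h1
      linarith

/-! ### Comparison of modulars -/

section
variable {α : ℝ} {ψ N : ℝ → ℝ}

theorem IsOrliczFunction.zero (hN : IsOrliczFunction α ψ N) : N 0 = 0 := (hN.eq_zero_iff 0).2 rfl

theorem IsOrliczFunction.nonneg (hN : IsOrliczFunction α ψ N) {u : ℝ} (hu : 0 ≤ u) : 0 ≤ N u :=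
  hN.zero ▸ hN.strictMonoOn.monotoneOn self_mem_Ici hu hu

theorem IsOrliczFunction.le_one_add (hN : IsOrliczFunction α ψ N) {u : ℝ} (hu : 0 ≤ u) :
    u ≤ 1 + N u / N 1 := by
  have h1 : 0 < N 1 := hN.zero ▸ hN.strictMonoOn self_mem_Ici (mem_Ici.2 zero_le_one) one_pos
  have h2 : 0 ≤ N u / N 1 := div_nonneg (hN.nonneg hu) h1.le
  rcases le_total u 1 with h | h
  · linarith
  have hu0 : 0 < u := by linarith
  have hc := hN.convexOn.2 (mem_univ u) (mem_univ 0) (by positivity : 0 ≤ 1 / u)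
    (by rw [sub_nonneg, div_le_one hu0]; exact h : 0 ≤ 1 - 1 / u) (by ring)
  simp only [smul_eq_mul, hN.zero, mul_zero, add_zero, one_div_mul_cancel hu0.ne'] at hc
  have : u ≤ N u / N 1 := by
    rw [le_div_iff₀ h1]
    calc u * N 1 ≤ u * (1 / u * N u) := by gcongr
      _ = N u := by field_simp
  linarith

theorem IsOrliczFunction.eq_exp_of_le_log (hN : IsOrliczFunction α ψ N) {u : ℝ} (hu : 0 < u)
    (h2 : 2 ≤ Real.log u) : N u = Real.exp (legendre α ψ (Real.log u)) :=
  hN.eq_exp u ((Real.le_log_iff_exp_le hu).1 h2)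

theorem integrable_of_memOrlicz {X : Type*} [MeasurableSpace X] {μ : Measure X}
    [IsFiniteMeasure μ] (hN : IsOrliczFunction α ψ N) {f : X → ℂ} (hf : MemOrlicz N μ f) :
    Integrable f μ := by
  refine ⟨hf.1, ?_⟩
  obtain ⟨v, hv⟩ := iInf_lt_iff.1 hf.2
  obtain ⟨hv0, hv⟩ := iInf_lt_iff.1 hv
  have hI : ∫⁻ x, ENNReal.ofReal (N (v * ‖f x‖)) ∂μ ≠ ∞ := by
    intro h
    rw [h, add_top, ENNReal.mul_top (ENNReal.inv_ne_zero.2 ENNReal.ofReal_ne_top)] at hv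
    exact lt_irrefl _ hv
  have h1 : ∀ x, ‖f x‖ₑ ≤ (ENNReal.ofReal v)⁻¹ *
      (1 + ENNReal.ofReal (N 1)⁻¹ * ENNReal.ofReal (N (v * ‖f x‖))) := fun x => by
    have hu : 0 ≤ v * ‖f x‖ := by positivity
    rw [← ENNReal.mul_le_iff_le_inv (by simpa using hv0) ENNReal.ofReal_ne_top,
      ← ENNReal.ofReal_mul (inv_nonneg.2 (hN.nonneg zero_le_one)), ← ofReal_norm,
      ← ENNReal.ofReal_mul hv0.le, ← ENNReal.ofReal_one, ← ENNReal.ofReal_add zero_le_one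
        (mul_nonneg (inv_nonneg.2 (hN.nonneg zero_le_one)) (hN.nonneg hu))]
    refine ENNReal.ofReal_le_ofReal ((hN.le_one_add hu).trans_eq ?_)
    rw [div_eq_inv_mul]
  refine lt_of_le_of_lt (lintegral_mono h1) ?_
  rw [lintegral_const_mul' _ _ (ENNReal.inv_ne_top.2 (by simpa using hv0)),
    lintegral_add_left measurable_const, lintegral_const_mul' _ _ ENNReal.ofReal_ne_top]
  refine ENNReal.mul_lt_top (ENNReal.inv_lt_top.2 (by simpa using hv0)) (ENNReal.add_lt_top.2
    ⟨?_, ENNReal.mul_lt_top ENNReal.ofReal_lt_top (lt_top_iff_ne_top.2 hI)⟩)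
  simp

theorem exp_sub_mul_log_eq {u c p : ℝ} (hu : 0 < u) (hc : 0 < c) :
    Real.exp (p * Real.log u - p * Real.log c) = (u / c) ^ p := by
  rw [Real.rpow_def_of_pos (div_pos hu hc), Real.log_div hu.ne' hc.ne']
  congr 1; ring

/-- For small `u`, monotonicity bounds `N u` by its value at a point where the exponential formula
holds, so the additive constant does not depend on how `N` is chosen near `0`. -/
theorem IsOrliczFunction.ofReal_le_sum (hψ : ClassPsi α ψ) (hN : IsOrliczFunction α ψ N)
    {p : ℕ → ℝ} {Y : ℝ} {c : ℝ≥0∞} (hp : ∀ j, α ≤ p j)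
    (h : ∀ y, Y ≤ y → ENNReal.ofReal (Real.exp (legendre α ψ y)) ≤
      c * ∑' j, ENNReal.ofReal (Real.exp (p j * y - p j * Real.log (ψ (p j)))))
    {u : ℝ} (hu : 0 ≤ u) :
    ENNReal.ofReal (N u) ≤ ENNReal.ofReal (Real.exp (legendre α ψ (max 2 Y))) +
      c * ∑' j, ENNReal.ofReal ((u / ψ (p j)) ^ p j) := by
  rcases le_total u (Real.exp (max 2 Y)) with hle | hle
  · refine le_trans ?_ le_self_add
    refine ENNReal.ofReal_le_ofReal ?_
    refine (hN.strictMonoOn.monotoneOn hu (Real.exp_pos _).le hle).trans_eq ?_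
    rw [hN.eq_exp_of_le_log (Real.exp_pos _) (by rw [Real.log_exp]; exact le_max_left _ _),
      Real.log_exp]
  · have hu0 : 0 < u := (Real.exp_pos _).trans_le hle
    have hlog := (Real.le_log_iff_exp_le hu0).2 hle
    refine le_trans ?_ le_add_self
    rw [hN.eq_exp_of_le_log hu0 ((le_max_left _ _).trans hlog)]
    refine (h _ ((le_max_right _ _).trans hlog)).trans_eq ?_
    simp only [exp_sub_mul_log_eq hu0 (hψ.pos_of_le (hp _))]

/-- The factor `e` in the denominators is the shift `y - 1` of the discretisation. For `u ≤ e^2` the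
series is bounded by its value at `e^2`, again independently of `N`. -/
theorem IsOrliczFunction.sum_le (hψ : ClassPsi α ψ) (hN : IsOrliczFunction α ψ N)
    {p : ℕ → ℝ} (hp : ∀ j, α ≤ p j)
    (h : ∀ y, ∑' j, ENNReal.ofReal (Real.exp (p j * (y - 1) - p j * Real.log (ψ (p j)))) ≤
      ENNReal.ofReal (4 * Real.exp (legendre α ψ y))) {u : ℝ} (hu : 0 ≤ u) :
    ∑' j, ENNReal.ofReal ((u / (Real.exp 1 * ψ (p j))) ^ p j) ≤
      ENNReal.ofReal (4 * Real.exp (legendre α ψ 2)) + 4 * ENNReal.ofReal (N u) := by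
  have conv : ∀ w : ℝ, 0 < w → ∑' j, ENNReal.ofReal ((w / (Real.exp 1 * ψ (p j))) ^ p j) ≤
      ENNReal.ofReal (4 * Real.exp (legendre α ψ (Real.log w))) := fun w hw => by
    refine le_trans (le_of_eq (tsum_congr fun j => ?_)) (h (Real.log w))
    have hj := hψ.pos_of_le (hp j)
    rw [← exp_sub_mul_log_eq hw (by positivity), Real.log_mul (Real.exp_pos 1).ne' hj.ne',
      Real.log_exp]
    congr 2; ring
  rcases le_total u (Real.exp 2) with hle | hle
  · refine le_trans ?_ le_self_add
    have h2 := conv _ (Real.exp_pos 2)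
    rw [Real.log_exp] at h2
    refine le_trans (ENNReal.tsum_le_tsum fun j => ENNReal.ofReal_le_ofReal ?_) h2
    have hj := hψ.pos_of_le (hp j)
    have h1 := hψ.one_le.trans (hp j)
    exact Real.rpow_le_rpow (by positivity) (by gcongr) (by linarith)
  · refine le_trans ?_ le_add_self
    have hu0 : 0 < u := (Real.exp_pos _).trans_le hle
    refine (conv u hu0).trans_eq ?_
    rw [← hN.eq_exp u hle, ENNReal.ofReal_mul (by norm_num)]
    norm_num

/-- The operator constant `(6p)^d` cancels exactly: `p^d` against the weight, `6^d` against the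
rescaling of `v`. -/
theorem lintegral_partialSum_term_le {d : ℕ} (M : ℕ) {f : (Fin d → ℝ) → ℂ}
    (hi : Integrable f (torusMeasure d)) {p c v : ℝ} (hp : 6 ≤ p) (hc : 0 < c) (hv : 0 < v) :
    ∫⁻ x, ENNReal.ofReal ((v / (Real.exp 1 * 6 ^ d) * ‖partialSum M f x‖ / (p ^ d * c)) ^ p)
        ∂(torusMeasure d) ≤
      ∫⁻ x, ENNReal.ofReal ((v * ‖f x‖ / (Real.exp 1 * c)) ^ p) ∂(torusMeasure d) := by
  have hp0 : 0 < p := by linarith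
  have factor : ∀ (s : ℝ) (F : (Fin d → ℝ) → ℂ), 0 ≤ s →
      ∫⁻ x, ENNReal.ofReal ((s * ‖F x‖) ^ p) ∂(torusMeasure d) =
        ENNReal.ofReal (s ^ p) * ∫⁻ x, ‖F x‖ₑ ^ p ∂(torusMeasure d) := fun s F hs => by
    rw [← lintegral_const_mul' _ _ ENNReal.ofReal_ne_top]
    refine lintegral_congr fun x => ?_
    rw [Real.mul_rpow hs (norm_nonneg _), ENNReal.ofReal_mul (by positivity),
      ← ENNReal.ofReal_rpow_of_nonneg (norm_nonneg _) hp0.le, ofReal_norm]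
  have e1 : ∀ x, v / (Real.exp 1 * 6 ^ d) * ‖partialSum M f x‖ / (p ^ d * c) =
      v / (Real.exp 1 * 6 ^ d) / (p ^ d * c) * ‖partialSum M f x‖ := fun x => by ring
  have e2 : ∀ x, v * ‖f x‖ / (Real.exp 1 * c) = v / (Real.exp 1 * c) * ‖f x‖ := fun x => by ring
  simp only [e1, e2]
  rw [factor _ _ (by positivity), factor _ _ (by positivity)]
  refine (mul_le_mul_right (lintegral_partialSum_le hp M hi) _).trans_eq ?_
  rw [← mul_assoc, ENNReal.ofReal_rpow_of_nonneg (by positivity) hp0.le,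
    ← ENNReal.ofReal_pow (by positivity), ← ENNReal.ofReal_mul (by positivity)]
  congr 2
  have hpow : ((6 * p) ^ p) ^ d = ((6 * p) ^ d) ^ p := by
    rw [← Real.rpow_natCast ((6 * p) ^ p), ← Real.rpow_mul (by positivity), mul_comm p,
      Real.rpow_mul (by positivity), Real.rpow_natCast]
  rw [hpow, ← Real.mul_rpow (by positivity) (by positivity)]
  congr 1
  rw [mul_pow]
  field_simp

/-- The modular inequality behind the boundedness of the cubic partial sums. -/
theorem ClassPsi.exists_modular_le (hψ : ClassPsi α ψ) (d : ℕ) :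
    ∃ C : ℝ, 0 < C ∧ ∀ N Nd : ℝ → ℝ, IsOrliczFunction α ψ N →
      IsOrliczFunction α (ExpOrlicz.psiPow d ψ) Nd → ∀ (f : (Fin d → ℝ) → ℂ),
      Integrable f (torusMeasure d) → ∀ (M : ℕ) (v : ℝ), 0 < v →
        1 + ∫⁻ x, ENNReal.ofReal (Nd (v / (Real.exp 1 * 6 ^ d) * ‖partialSum M f x‖))
          ∂(torusMeasure d) ≤
        ENNReal.ofReal C * (1 + ∫⁻ x, ENNReal.ofReal (N (v * ‖f x‖)) ∂(torusMeasure d)) := by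
  obtain ⟨p, Y, hp, hup, hlow⟩ := hψ.exists_discretisation d
  set c : ℝ := Real.exp (2 + 2 * d)
  set K : ℝ := Real.exp (legendre α (ExpOrlicz.psiPow d ψ) (max 2 Y))
  set K' : ℝ := 4 * Real.exp (legendre α ψ 2)
  have hc0 : 0 < c := Real.exp_pos _
  have hK0 : 0 < K := Real.exp_pos _
  have hK0' : 0 < K' := mul_pos (by norm_num) (Real.exp_pos _)
  refine ⟨1 + K + c * K' + c * 4, by positivity, fun N Nd hN hNd f hi M v hv => ?_⟩
  set w := v / (Real.exp 1 * 6 ^ d)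
  have hw : 0 < w := by positivity
  set I := ∫⁻ x, ENNReal.ofReal (N (v * ‖f x‖)) ∂(torusMeasure d)
  have hsum : ∑' j, ∫⁻ x, ENNReal.ofReal
      ((w * ‖partialSum M f x‖ / ExpOrlicz.psiPow d ψ (p j)) ^ p j) ∂(torusMeasure d) ≤
      ENNReal.ofReal K' + 4 * I := by
    calc _ ≤ ∑' j, ∫⁻ x, ENNReal.ofReal ((v * ‖f x‖ / (Real.exp 1 * ψ (p j))) ^ p j)
          ∂(torusMeasure d) := ENNReal.tsum_le_tsum fun j =>
            lintegral_partialSum_term_le M hi (hp j).1 (hψ.pos_of_le (hp j).2) hv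
      _ = ∫⁻ x, ∑' j, ENNReal.ofReal ((v * ‖f x‖ / (Real.exp 1 * ψ (p j))) ^ p j)
          ∂(torusMeasure d) := (lintegral_tsum fun j =>
            ((((hi.1.norm.aemeasurable.const_mul v).div_const _).pow_const _).ennreal_ofReal)).symm
      _ ≤ ∫⁻ x, (ENNReal.ofReal K' + 4 * ENNReal.ofReal (N (v * ‖f x‖))) ∂(torusMeasure d) :=
          lintegral_mono fun x => hN.sum_le hψ (fun j => (hp j).2) hlow (by positivity)
      _ = _ := by
          rw [lintegral_add_left measurable_const, lintegral_const_mul' _ _ (by norm_num)]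
          simp [I]
  have hT : Continuous fun x => w * ‖partialSum M f x‖ :=
    (continuous_partialSum M f).norm.const_mul w
  have hmain : ∫⁻ x, ENNReal.ofReal (Nd (w * ‖partialSum M f x‖)) ∂(torusMeasure d) ≤
      ENNReal.ofReal K + ENNReal.ofReal c * (ENNReal.ofReal K' + 4 * I) := by
    calc _ ≤ ∫⁻ x, (ENNReal.ofReal K + ENNReal.ofReal c * ∑' j, ENNReal.ofReal
          ((w * ‖partialSum M f x‖ / ExpOrlicz.psiPow d ψ (p j)) ^ p j)) ∂(torusMeasure d) :=
          lintegral_mono fun x => hNd.ofReal_le_sum (hψ.psiPow d) (fun j => (hp j).2) hup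
            (by positivity)
      _ = ENNReal.ofReal K + ENNReal.ofReal c * ∑' j, ∫⁻ x, ENNReal.ofReal
          ((w * ‖partialSum M f x‖ / ExpOrlicz.psiPow d ψ (p j)) ^ p j) ∂(torusMeasure d) := by
          rw [lintegral_add_left measurable_const, lintegral_const_mul' _ _ ENNReal.ofReal_ne_top,
            lintegral_tsum fun j =>
              (((hT.measurable.div_const _).pow_const _).ennreal_ofReal).aemeasurable]
          simp
      _ ≤ _ := by gcongr
  calc _ ≤ 1 + (ENNReal.ofReal K + ENNReal.ofReal c * (ENNReal.ofReal K' + 4 * I)) := by gcongr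
    _ = (1 + ENNReal.ofReal K + ENNReal.ofReal c * ENNReal.ofReal K') * 1 +
        (ENNReal.ofReal c * 4) * I := by ring
    _ ≤ (1 + ENNReal.ofReal K + ENNReal.ofReal c * ENNReal.ofReal K' + ENNReal.ofReal c * 4) * 1 +
        (1 + ENNReal.ofReal K + ENNReal.ofReal c * ENNReal.ofReal K' + ENNReal.ofReal c * 4) * I :=
        add_le_add (mul_le_mul' le_self_add le_rfl) (mul_le_mul' le_add_self le_rfl)
    _ = _ := by
        rw [← mul_add]
        congr 1
        rw [ENNReal.ofReal_add (by positivity) (by positivity),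
          ENNReal.ofReal_add (by positivity) (by positivity),
          ENNReal.ofReal_add (by positivity) (by positivity), ENNReal.ofReal_mul hc0.le,
          ENNReal.ofReal_mul hc0.le]
        norm_num

end

end ExpOrlicz

theorem theorem1 (d : ℕ) (hd : 1 ≤ d) (α : ℝ) (ψ : ℝ → ℝ) (hψ : ExpOrlicz.ClassPsi α ψ) :
    ∃ C : ℝ, 0 < C ∧
      ∀ N Nd : ℝ → ℝ, ExpOrlicz.IsOrliczFunction α ψ N →
        ExpOrlicz.IsOrliczFunction α (ExpOrlicz.psiPow d ψ) Nd →
        ∀ f : (Fin d → ℝ) → ℂ, ExpOrlicz.MemOrlicz N (ExpOrlicz.torusMeasure d) f →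
          Integrable f (ExpOrlicz.torusMeasure d) ∧
          (∀ M : ℕ, 1 ≤ M → ExpOrlicz.MemOrlicz Nd (ExpOrlicz.torusMeasure d)
            (ExpOrlicz.partialSum M f)) ∧
          (⨆ (M : ℕ) (_ : 1 ≤ M), ExpOrlicz.orliczNorm Nd (ExpOrlicz.torusMeasure d)
              (ExpOrlicz.partialSum M f)) ≤
            ENNReal.ofReal C * ExpOrlicz.orliczNorm N (ExpOrlicz.torusMeasure d) f := by
  obtain ⟨C, hC, hmod⟩ := hψ.exists_modular_le d
  have hκ : 0 < Real.exp 1 * 6 ^ d := by positivity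
  have hA : 0 < Real.exp 1 * 6 ^ d * C := mul_pos hκ hC
  refine ⟨Real.exp 1 * 6 ^ d * C, hA, fun N Nd hN hNd f hf => ?_⟩
  have hi := ExpOrlicz.integrable_of_memOrlicz hN hf
  have bound : ∀ M : ℕ, ExpOrlicz.orliczNorm Nd (ExpOrlicz.torusMeasure d)
      (ExpOrlicz.partialSum M f) ≤ ENNReal.ofReal (Real.exp 1 * 6 ^ d * C) *
        ExpOrlicz.orliczNorm N (ExpOrlicz.torusMeasure d) f := fun M => by
    have hA0 : ENNReal.ofReal (Real.exp 1 * 6 ^ d * C) ≠ 0 := by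
      rw [Ne, ENNReal.ofReal_eq_zero, not_le]; exact hA
    have hκ' : ENNReal.ofReal (Real.exp 1 * 6 ^ d) ≠ 0 := by
      rw [Ne, ENNReal.ofReal_eq_zero, not_le]; exact hκ
    simp only [ExpOrlicz.orliczNorm]
    rw [ENNReal.mul_iInf_of_ne hA0 ENNReal.ofReal_ne_top]
    refine le_iInf fun v => ?_
    rw [ENNReal.mul_iInf_of_ne hA0 ENNReal.ofReal_ne_top]
    refine le_iInf fun hv => ?_
    -- Testing the left norm at the rescaled parameter costs the factor `e 6^d` from `1/v`, whence
    -- the constant `e 6^d C`.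
    refine (iInf₂_le (v / (Real.exp 1 * 6 ^ d)) (div_pos hv hκ)).trans ?_
    refine (mul_le_mul_right (hmod N Nd hN hNd f hi M v hv) _).trans_eq ?_
    rw [ENNReal.ofReal_mul hκ.le, ENNReal.ofReal_div_of_pos hκ, ENNReal.inv_div
      (Or.inl ENNReal.ofReal_ne_top) (Or.inl hκ'), div_eq_mul_inv]
    ring
  refine ⟨hi, fun M _ => ⟨(ExpOrlicz.continuous_partialSum M f).aestronglyMeasurable, ?_⟩,
    iSup₂_le fun M _ => bound M⟩
  exact (bound M).trans_lt (ENNReal.mul_lt_top ENNReal.ofReal_lt_top hf.2)
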